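/- An \emph{$h$-disjoint convex obstacle representation} of a finite simple graph $G$ consists of an assignment of distinct points of the plane $\mathbb{R}^2$ to the vertices of $G$, together with $h$ pairwise disjoint convex polygons (closed regions, called obstacles), such that no three points among the points representing vertices and the vertices of the polygons lie on a line, and such that any two distinct vertices of $G$ are adjacent if and only if the line segment between the corresponding points meets none of the obstacles. The \emph{disjoint convex obstacle number} of $G$ is the smallest $h$ for which $G$ has an $h$-disjoint convex obstacle representation. \textbf{Theorem 2.} There are trees whose disjoint convex obstacle number is at least four. More precisely, there is a number $K$ such that for every $k \ge K$ the full complete $k$-ary tree of height $3$ (the rooted tree in which every vertex at distance less than $3$ from the root has exactly $k$ children, and the vertices at distance $3$ from the root are leaves) has disjoint convex obstacle number at least four. -/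

import Mathlib

/-- The Euclidean plane. -/
abbrev Plane : Type := EuclideanSpace ℝ (Fin 2)

/-- A set of points in the plane is in general position if no three of its points lie on a line. -/
def InGeneralPosition (S : Set Plane) : Prop :=
  ∀ p ∈ S, ∀ q ∈ S, ∀ r ∈ S, p ≠ q → p ≠ r → q ≠ r → ¬ Collinear ℝ {p, q, r}

/-- A convex polygon, given by its finite set of vertices: there are at least three of them and
none lies in the convex hull of the others. -/
structure ConvexPolygon where
  /-- the vertices of the polygon -/
  verts : Finset Plane
  three_le_card : 3 ≤ verts.card
  convexIndependent : ConvexIndependent ℝ (fun p : {x // x ∈ verts} => (p : Plane))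

/-- The closed region of the plane occupied by a convex polygon. -/
def ConvexPolygon.region (P : ConvexPolygon) : Set Plane :=
  convexHull ℝ (P.verts : Set Plane)

/-- An `h`-convex obstacle representation of a graph: distinct points for the vertices and `h`
convex polygons (the obstacles), with the points and the polygon vertices together in general
position, such that two vertices are adjacent if and only if the segment between their points
meets no obstacle. -/
structure ConvexObstacleRep {V : Type*} (G : SimpleGraph V) (h : ℕ) where
  /-- the point that represents a vertex -/
  pt : V → Plane
  /-- the obstacles -/
  obstacle : Fin h → ConvexPolygon
  pt_injective : Function.Injective pt
  generalPosition :
    InGeneralPosition (Set.range pt ∪ ⋃ i, ((obstacle i).verts : Set Plane))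
  adj_iff : ∀ u v : V, u ≠ v →
    (G.Adj u v ↔ ∀ i, Disjoint (segment ℝ (pt u) (pt v)) (obstacle i).region)

/-- An `h`-disjoint convex obstacle representation: the convex obstacles are pairwise disjoint. -/
structure DisjointConvexObstacleRep {V : Type*} (G : SimpleGraph V) (h : ℕ)
    extends ConvexObstacleRep G h where
  pairwise_disjoint : ∀ i j, i ≠ j → Disjoint (obstacle i).region (obstacle j).region

/-- The disjoint convex obstacle number of a graph: the smallest `h` for which it has an
`h`-disjoint convex obstacle representation. -/
noncomputable def disjointConvexObstacleNumber {V : Type*} (G : SimpleGraph V) : ℕ∞ :=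
  ⨅ h ∈ {h : ℕ | Nonempty (DisjointConvexObstacleRep G h)}, (h : ℕ∞)

/-- The full complete `k`-ary tree of height `h`. Its vertices are the words of length at most `h`
over a `k`-letter alphabet, the root is the empty word, the depth of a word is its length, and the
children of a word `l` of length less than `h` are the `k` words `a :: l`. -/
def fullTree (k h : ℕ) : SimpleGraph {l : List (Fin k) // l.length ≤ h} where
  Adj u v := (∃ a, v.1 = a :: u.1) ∨ (∃ a, u.1 = a :: v.1)
  symm := ⟨fun _ _ huv => Or.symm huv⟩
  loopless := ⟨fun u hu => by
    rcases hu with ⟨a, ha⟩ | ⟨a, ha⟩ <;> simpa using congrArg List.length ha⟩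

/-!
Three disjoint convex obstacles cannot represent a tree in which every vertex of the first three
levels has many children. Only the convexity, closedness and disjointness of the obstacles matter,
and a single leaf below each vertex of depth two; general position is not used.

Ramsey's theorem, applied to the non-adjacent children of a vertex `o`, gives many children that are
pairwise hidden by the same obstacle `X`. By a Radon type argument (`exists_inShadow`) all but two of
them lie between `o` and `X`. Sort them by angle. The two other obstacles, being convex and disjoint
from `X`, cannot reach into all of three consecutive blocks, which leaves a block such that neither of
them enters the triangle that it spans with `o`. A neighbour of one of these children that is hidden
from `o` must then lie outside the triangle, and the edge to it leaves the triangle sideways, crossing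
the edges from `o` to all children on one side (`sortedFan`, `exists_sorted_star`).

Apply this to the root `r`, with obstacle `A`, and to each of its sorted children `c`, with an
obstacle `X`, the neighbours `g` of `c` being chosen so that the same obstacle `B ≠ A` hides them from
`r` and their edges cross the edges from `r` to its other children on the same side. By the pigeonhole
principle three children `c₀`, `c₁`, `c₂` agree in `B`, `X` and the side. Elementary incidences
(`hit_of_shadow`, `hit_cevian`, `hit_diagonal`) show that `c₀` and `g` are hidden from each other by
the third obstacle `C` alone. The three possibilities for `X` are then refuted in turn:

* `X = A` would let `A` hide `c₀` from `r` (`Overlap.false_of_behind`);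
* `X = B` is refuted in the triangle formed by `c₁`, a neighbour `h` of `c₂`, and the crossing of
  `c₂ h` with `r c₁`: it contains every such `g` at `c₁`, so that `B` would cross `c₁ h`
  (`BlockerStar.elim`);
* `X = C` is refuted with a leaf `l` at a neighbour `h` of `c₁`, whose edge crosses that from `c₁` to
  another neighbour `g`: of `A` and `B`, one hides `l` from `c₁` and the other hides it from `g`, and
  in every position of `l` some obstacle meets an edge, or `A` and `B` enter regions closed to them
  (`ThirdStar.elim`).

The last two arguments are carried out in affine coordinates in which `c₁` is the origin, `r = (1, 0)`
and `c₀ = (0, 1)`.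
-/

/-! ### Segments that hit a convex set -/

/-- The segment from `p` to `q` meets the set `X`: seen from `p`, the obstacle `X` hides `q`. -/
def Hit (X : Set (ℝ × ℝ)) (p q : ℝ × ℝ) : Prop := ∃ x ∈ segment ℝ p q, x ∈ X

lemma mem_seg {p q x : ℝ × ℝ} : x ∈ segment ℝ p q ↔
    ∃ t : ℝ, 0 ≤ t ∧ t ≤ 1 ∧ x.1 = (1 - t) * p.1 + t * q.1 ∧ x.2 = (1 - t) * p.2 + t * q.2 := by
  constructor
  · rintro ⟨a, b, ha, hb, hab, rfl⟩
    refine ⟨b, hb, by linarith, ?_, ?_⟩ <;> simp [← hab]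
  · rintro ⟨t, h0, h1, e1, e2⟩
    refine ⟨1 - t, t, by linarith, h0, by ring, ?_⟩
    ext <;> simp [e1, e2]

lemma hit_comm {X : Set (ℝ × ℝ)} {p q : ℝ × ℝ} (h : Hit X p q) : Hit X q p := by
  obtain ⟨x, hx, hX⟩ := h
  exact ⟨x, segment_symm ℝ p q ▸ hx, hX⟩

lemma seg_symm {x p q : ℝ × ℝ} (h : x ∈ segment ℝ p q) : x ∈ segment ℝ q p :=
  segment_symm ℝ p q ▸ h

lemma seg_sub {p q x y z : ℝ × ℝ} (hx : x ∈ segment ℝ p q) (hy : y ∈ segment ℝ p q)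
    (hz : z ∈ segment ℝ x y) : z ∈ segment ℝ p q :=
  (convex_segment p q).segment_subset hx hy hz

lemma Hit.mono {X : Set (ℝ × ℝ)} {p q x y : ℝ × ℝ} (h : Hit X x y) (hx : x ∈ segment ℝ p q)
    (hy : y ∈ segment ℝ p q) : Hit X p q := by
  obtain ⟨z, hz, hX⟩ := h
  exact ⟨z, seg_sub hx hy hz, hX⟩

lemma seg_left (p q : ℝ × ℝ) : p ∈ segment ℝ p q := left_mem_segment ℝ p q

lemma seg_right (p q : ℝ × ℝ) : q ∈ segment ℝ p q := right_mem_segment ℝ p q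

/-- Two cevians of a triangle `p z a` cross. -/
lemma cevians_cross {p z a x q : ℝ × ℝ} (hx : x ∈ segment ℝ p z) (hq : q ∈ segment ℝ p a) :
    ∃ y, y ∈ segment ℝ x a ∧ y ∈ segment ℝ q z := by
  obtain ⟨s, hs0, hs1, x1, x2⟩ := mem_seg.1 hx
  obtain ⟨t, ht0, ht1, q1, q2⟩ := mem_seg.1 hq
  rcases eq_or_ne (s * t) 1 with h | h
  · have hs : s = 1 := by nlinarith
    have ht : t = 1 := by nlinarith
    subst hs ht
    refine ⟨a, seg_right _ _, ?_⟩
    have : q = a := by ext <;> linarith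
    rw [this]; exact seg_left _ _
  · have hst : 0 < 1 - s * t := by
      have : s * t ≤ 1 := by nlinarith
      exact sub_pos.2 (lt_of_le_of_ne this h)
    have hu : t * (1 - s) / (1 - s * t) ≤ 1 := by
      rw [div_le_one hst]; nlinarith
    have hv : s * (1 - t) / (1 - s * t) ≤ 1 := by
      rw [div_le_one hst]; nlinarith
    have hd : (1 - s * t)⁻¹ * (1 - s * t) = 1 := inv_mul_cancel₀ hst.ne'
    refine ⟨((1 - t * (1 - s) / (1 - s * t)) • x + (t * (1 - s) / (1 - s * t)) • a), ?_, ?_⟩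
    · exact mem_seg.2 ⟨_, div_nonneg (mul_nonneg ht0 (by linarith)) hst.le, hu, by simp, by simp⟩
    · refine mem_seg.2 ⟨_, div_nonneg (mul_nonneg hs0 (by linarith)) hst.le, hv, ?_, ?_⟩
      · simp only [Prod.fst_add, Prod.smul_fst, smul_eq_mul, x1, q1, div_eq_mul_inv]
        linear_combination ((s - t) * p.1 - s * z.1 + t * a.1) * hd
      · simp only [Prod.snd_add, Prod.smul_snd, smul_eq_mul, x2, q2, div_eq_mul_inv]
        linear_combination ((s - t) * p.2 - s * z.2 + t * a.2) * hd

/-- If `q` lies between `p` and a point of `X`, then everything hidden from `p` by `X` is hidden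
from `q` as well. -/
lemma hit_of_shadow {X : Set (ℝ × ℝ)} (hX : Convex ℝ X) {p q a z : ℝ × ℝ} (ha : a ∈ X)
    (hq : q ∈ segment ℝ p a) (h : Hit X p z) : Hit X q z := by
  obtain ⟨x, hx, hxX⟩ := h
  obtain ⟨y, hy, hy'⟩ := cevians_cross hx hq
  exact ⟨y, hy', hX.segment_subset hxX ha hy⟩

/-- A convex set that meets two sides of a triangle meets the cevian from their common vertex. -/
lemma hit_cevian {X : Set (ℝ × ℝ)} (hX : Convex ℝ X) {a b c p : ℝ × ℝ}
    (h1 : Hit X b a) (h2 : Hit X b c) (hp : p ∈ segment ℝ a c) : Hit X b p := by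
  obtain ⟨x, hx, hxX⟩ := h1
  obtain ⟨y, hy, hyX⟩ := h2
  obtain ⟨s, hs0, hs1, x1, x2⟩ := mem_seg.1 hx
  obtain ⟨t, ht0, ht1, y1, y2⟩ := mem_seg.1 hy
  obtain ⟨l, hl0, hl1, p1, p2⟩ := mem_seg.1 hp
  -- the point of `[x, y]` with barycentric coordinates at `a` and `c` proportional to those of `p`
  rcases eq_or_lt_of_le (show 0 ≤ t * (1 - l) + s * l by
    have := mul_nonneg ht0 (sub_nonneg.2 hl1); have := mul_nonneg hs0 hl0; linarith) with h | h
  · have h3 : t * (1 - l) = 0 := by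
      have := mul_nonneg ht0 (sub_nonneg.2 hl1); have := mul_nonneg hs0 hl0; linarith
    have h4 : s * l = 0 := by linarith
    have hb : b ∈ X := by
      rcases mul_eq_zero.1 h3 with h5 | h5
      · subst h5
        have : y = b := by ext <;> linarith
        exact this ▸ hyX
      · have : l = 1 := by linarith
        subst this
        have h6 : s = 0 := by linarith
        subst h6
        have : x = b := by ext <;> linarith
        exact this ▸ hxX
    exact ⟨b, seg_left _ _, hb⟩
  · have hm0 : 0 ≤ s * l / (t * (1 - l) + s * l) := div_nonneg (mul_nonneg hs0 hl0) h.le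
    have hm1 : s * l / (t * (1 - l) + s * l) ≤ 1 := by
      rw [div_le_one h]; have := mul_nonneg ht0 (sub_nonneg.2 hl1); linarith
    have hk1 : s * t / (t * (1 - l) + s * l) ≤ 1 := by
      rw [div_le_one h]
      nlinarith [mul_nonneg (mul_nonneg ht0 (sub_nonneg.2 hl1)) (sub_nonneg.2 hs1),
        mul_nonneg (mul_nonneg hs0 hl0) (sub_nonneg.2 ht1)]
    have h' := h.ne'
    refine ⟨(1 - s * l / (t * (1 - l) + s * l)) • x + (s * l / (t * (1 - l) + s * l)) • y, ?_,
      hX hxX hyX (by linarith) hm0 (by ring)⟩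
    refine mem_seg.2 ⟨s * t / (t * (1 - l) + s * l), div_nonneg (mul_nonneg hs0 ht0) h.le, hk1,
      ?_, ?_⟩
    · simp only [Prod.fst_add, Prod.smul_fst, smul_eq_mul, x1, y1, p1]
      field_simp; ring
    · simp only [Prod.snd_add, Prod.smul_snd, smul_eq_mul, x2, y2, p2]
      field_simp; ring

/-- A convex set that meets two opposite sides of a convex quadrilateral meets both diagonals. -/
lemma hit_diagonal {X : Set (ℝ × ℝ)} (hX : Convex ℝ X) {a b c d p : ℝ × ℝ}
    (hp : p ∈ segment ℝ a b) (hp' : p ∈ segment ℝ c d) (h1 : Hit X a c) (h2 : Hit X b d) :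
    Hit X a b := by
  obtain ⟨x, hx, hxX⟩ := h1
  obtain ⟨y, hy, hyX⟩ := h2
  obtain ⟨s, hs0, hs1, x1, x2⟩ := mem_seg.1 hx
  obtain ⟨t, ht0, ht1, y1, y2⟩ := mem_seg.1 hy
  obtain ⟨l, hl0, hl1, p1, p2⟩ := mem_seg.1 hp
  obtain ⟨m, hm0, hm1, p1', p2'⟩ := mem_seg.1 hp'
  have hsm := mul_nonneg hs0 hm0
  have htm := mul_nonneg ht0 (sub_nonneg.2 hm1)
  rcases eq_or_lt_of_le (show 0 ≤ t * (1 - m) + s * m by linarith) with h | h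
  · have h3 : t * (1 - m) = 0 := by linarith
    have h4 : s * m = 0 := by linarith
    rcases mul_eq_zero.1 h4 with h5 | h5
    · subst h5
      have : x = a := by ext <;> linarith
      exact ⟨x, this ▸ seg_left _ _, hxX⟩
    · subst h5
      have h5 : t = 0 := by linarith
      subst h5
      have : y = b := by ext <;> linarith
      exact ⟨y, this ▸ seg_right _ _, hyX⟩
  · -- on `[x, y]` the weights at `c` and `d` are balanced as in `p` at this parameter
    have h' := h.ne'
    have hw0 : 0 ≤ s * m / (t * (1 - m) + s * m) := div_nonneg hsm h.le
    have hw1 : s * m / (t * (1 - m) + s * m) ≤ 1 := by rw [div_le_one h]; linarith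
    have hk : s * t / (t * (1 - m) + s * m) ≤ 1 := by
      rw [div_le_one h]
      nlinarith [mul_nonneg htm (sub_nonneg.2 hs1), mul_nonneg hsm (sub_nonneg.2 ht1)]
    have hk0 : 0 ≤ s * t / (t * (1 - m) + s * m) := div_nonneg (mul_nonneg hs0 ht0) h.le
    refine ⟨(1 - s * m / (t * (1 - m) + s * m)) • x + (s * m / (t * (1 - m) + s * m)) • y, ?_,
      hX hxX hyX (by linarith) hw0 (by ring)⟩
    -- weight of `b`: `w (1 - t) + (s t / N) l`
    refine mem_seg.2 ⟨s * m / (t * (1 - m) + s * m) * (1 - t)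
      + s * t / (t * (1 - m) + s * m) * l, by
        have := mul_nonneg hw0 (sub_nonneg.2 ht1); have := mul_nonneg hk0 hl0; linarith, ?_, ?_, ?_⟩
    · have e : 1 - (s * m / (t * (1 - m) + s * m) * (1 - t) + s * t / (t * (1 - m) + s * m) * l)
          = (1 - s * m / (t * (1 - m) + s * m)) * (1 - s)
            + s * t / (t * (1 - m) + s * m) * (1 - l) := by
        field_simp; ring
      have := mul_nonneg (sub_nonneg.2 hw1) (sub_nonneg.2 hs1)
      have := mul_nonneg hk0 (sub_nonneg.2 hl1)
      linarith
    · simp only [Prod.fst_add, Prod.smul_fst, smul_eq_mul, x1, y1]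
      field_simp
      linear_combination (s * t) * (p1 - p1')
    · simp only [Prod.snd_add, Prod.smul_snd, smul_eq_mul, x2, y2]
      field_simp
      linear_combination (s * t) * (p2 - p2')

/-- Let `X` be convex. If `X` has a point in the triangle `c g l` and a point in the cone at `c`
spanned by `g` and `l` on the far side of the line through `g` and `l`, then it meets the
segment from `g` to `l`. -/
lemma hit_base {X : Set (ℝ × ℝ)} (hX : Convex ℝ X) {c g l x u : ℝ × ℝ} {a b a' b' : ℝ}
    (hx : x ∈ X) (hu : u ∈ X) (ha : 0 ≤ a) (hb : 0 ≤ b) (hab : a + b ≤ 1)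
    (ha' : 0 ≤ a') (hb' : 0 ≤ b') (hab' : 1 ≤ a' + b')
    (ex : x = c + a • (g - c) + b • (l - c)) (eu : u = c + a' • (g - c) + b' • (l - c)) :
    Hit X g l := by
  have key : ∃ s : ℝ, 0 ≤ s ∧ s ≤ 1 ∧ (1 - s) * (a + b) + s * (a' + b') = 1 := by
    rcases eq_or_lt_of_le hab with h | h
    · exact ⟨0, le_rfl, zero_le_one, by linarith⟩
    · have h1 : 0 < a' + b' - (a + b) := by linarith
      refine ⟨(1 - (a + b)) / (a' + b' - (a + b)), div_nonneg (by linarith) h1.le, ?_, ?_⟩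
      · rw [div_le_one h1]; linarith
      · field_simp; ring
  obtain ⟨s, hs0, hs1, hs⟩ := key
  refine ⟨(1 - s) • x + s • u, ?_, hX hx hu (by linarith) hs0 (by ring)⟩
  have e1 : 0 ≤ (1 - s) * a + s * a' := by
    have := mul_nonneg (sub_nonneg.2 hs1) ha; have := mul_nonneg hs0 ha'; linarith
  refine mem_seg.2 ⟨(1 - s) * b + s * b', ?_, by linarith, ?_, ?_⟩
  · have := mul_nonneg (sub_nonneg.2 hs1) hb; have := mul_nonneg hs0 hb'; linarith
  · simp [ex, eu]
    linear_combination (g.1 - c.1) * hs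
  · simp [ex, eu]
    linear_combination (g.2 - c.2) * hs

/-! ### The neighbours of a point that are pairwise hidden by one obstacle -/

/-- The determinant of two vectors of the plane. -/
def det (u v : ℝ × ℝ) : ℝ := u.1 * v.2 - u.2 * v.1

lemma cramer (x : ℝ × ℝ) {y z : ℝ × ℝ} (h : det y z ≠ 0) :
    x = (det x z / det y z) • y + (det y x / det y z) • z := by
  have hd := inv_mul_cancel₀ h
  unfold det at *
  ext
  · simp [div_eq_mul_inv]
    linear_combination (-x.1) * hd
  · simp [div_eq_mul_inv]
    linear_combination (-x.2) * hd

lemma seg_ray {d : ℝ × ℝ} {a m n : ℝ} (h1 : a ≤ m) (h2 : m ≤ n) :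
    m • d ∈ segment ℝ (a • d) (n • d) := by
  rcases eq_or_lt_of_le (h1.trans h2) with h | h
  · have : m = a := le_antisymm (h ▸ h2) h1
    exact this ▸ seg_left _ _
  · have h' : n - a ≠ 0 := (sub_pos.2 h).ne'
    refine mem_seg.2 ⟨(m - a) / (n - a), div_nonneg (by linarith) (by linarith), ?_, ?_, ?_⟩
    · rw [div_le_one (by linarith)]; linarith
    · simp; field_simp; ring
    · simp; field_simp; ring

lemma seg_ray_zero {d : ℝ × ℝ} {m n : ℝ} (h1 : 0 ≤ m) (h2 : m ≤ n) :
    m • d ∈ segment ℝ 0 (n • d) := by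
  simpa using seg_ray (d := d) h1 h2

lemma seg_ray_one {d : ℝ × ℝ} {m : ℝ} (h1 : 0 ≤ m) (h2 : m ≤ 1) : m • d ∈ segment ℝ 0 d := by
  simpa using seg_ray_zero (d := d) h1 h2

lemma mem_seg_zero {d x : ℝ × ℝ} (h : x ∈ segment ℝ 0 d) : ∃ t : ℝ, 0 ≤ t ∧ t ≤ 1 ∧ x = t • d := by
  obtain ⟨t, h0, h1, e1, e2⟩ := mem_seg.1 h
  exact ⟨t, h0, h1, by ext <;> simp [e1, e2]⟩

lemma seg_comb {u v : ℝ × ℝ} {a b : ℝ} (ha : 0 ≤ a) (hb : 0 ≤ b) (hab : a + b = 1) :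
    a • u + b • v ∈ segment ℝ u v := ⟨a, b, ha, hb, hab, rfl⟩

lemma hit_zero_right {X : Set (ℝ × ℝ)} {u v : ℝ × ℝ} (h : Hit X u v) (hu : ¬ Hit X 0 u) :
    v ≠ 0 := by
  rintro rfl
  exact hu (hit_comm h)

lemma exists_smul_of_det_eq_zero {u v : ℝ × ℝ} (hu : u ≠ 0) (h : det u v = 0) :
    ∃ t : ℝ, v = t • u := by
  unfold det at h
  by_cases h1 : u.1 = 0
  · have h2 : u.2 ≠ 0 := fun h2 => hu (by ext <;> simp [h1, h2])
    have h3 : v.1 = 0 := by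
      rw [h1] at h
      have : u.2 * v.1 = 0 := by linarith
      exact (mul_eq_zero.1 this).resolve_left h2
    exact ⟨v.2 / u.2, by ext <;> simp [h1, h2, h3]⟩
  · refine ⟨v.1 / u.1, ?_⟩
    ext
    · simp [h1]
    · simp; field_simp; linarith

/-- Two points that are hidden from each other by `X`, but not from the origin, are not on a line
through the origin. -/
lemma det_ne_zero_of_hit {X : Set (ℝ × ℝ)} {u v : ℝ × ℝ} (h : Hit X u v) (hu : ¬ Hit X 0 u)
    (hv : ¬ Hit X 0 v) : det u v ≠ 0 := by
  intro hd
  have hu0 : u ≠ 0 := hit_zero_right (hit_comm h) hv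
  obtain ⟨t, rfl⟩ := exists_smul_of_det_eq_zero hu0 hd
  obtain ⟨x, hx, hX⟩ := h
  obtain ⟨s, hs0, hs1, e1, e2⟩ := mem_seg.1 hx
  have ex : x = (1 - s + s * t) • u := by
    ext
    · simp at e1 ⊢; rw [e1]; ring
    · simp at e2 ⊢; rw [e2]; ring
  -- the segment `[u, t u]` is covered by `[0, u]` and `[0, t u]`
  by_cases hk : 0 ≤ 1 - s + s * t ∧ 1 - s + s * t ≤ 1
  · exact hu ⟨x, ex ▸ seg_ray_one hk.1 hk.2, hX⟩
  · refine hv ⟨x, ?_, hX⟩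
    rw [ex]
    rcases le_or_gt 0 (1 - s + s * t) with h0 | h0
    · refine seg_ray_zero h0 ?_
      have h1 : 1 < 1 - s + s * t := by
        by_contra h1
        exact hk ⟨h0, not_lt.1 h1⟩
      have ht : 1 < t := by
        by_contra ht
        nlinarith [mul_nonneg hs0 (sub_nonneg.2 (not_lt.1 ht))]
      nlinarith [mul_nonneg (sub_nonneg.2 hs1) (sub_pos.2 ht).le]
    · have ht : t < 1 := by
        by_contra ht
        nlinarith [mul_nonneg hs0 (sub_nonneg.2 (not_lt.1 ht))]
      have := seg_ray (d := u) (show t ≤ 1 - s + s * t by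
        nlinarith [mul_nonneg (sub_nonneg.2 hs1) (sub_pos.2 ht).le]) h0.le
      rw [zero_smul] at this
      exact seg_symm this

/-- The point `d` lies between the origin and a point of `X`. -/
def InShadow (X : Set (ℝ × ℝ)) (d : ℝ × ℝ) : Prop := ∃ a ∈ X, d ∈ segment ℝ 0 a

/-- If `X` separates `d` from `u` and `v` but hides neither `d` nor `u` from the origin, and `d` lies
in the cone spanned by `u` and `v`, then `X` has a point behind `d`: it meets the cevian from `d`
to the segment `[u, v]`, and cannot do so on the near side of `d`. -/
lemma inShadow_of_cone {X : Set (ℝ × ℝ)} (hX : Convex ℝ X) {d u v : ℝ × ℝ} {b c : ℝ}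
    (hb : 0 ≤ b) (hc : 0 ≤ c) (e : d = b • u + c • v) (h1 : Hit X d u) (h2 : Hit X d v)
    (hd : ¬ Hit X 0 d) (hu : ¬ Hit X 0 u) : InShadow X d := by
  have hd0 : d ≠ 0 := hit_zero_right (hit_comm h1) hu
  have hS : 0 < b + c := by
    refine lt_of_le_of_ne (by linarith) fun h => hd0 ?_
    have hb0 : b = 0 := by linarith
    have hc0 : c = 0 := by linarith
    simp [e, hb0, hc0]
  have hw : (b + c)⁻¹ • d ∈ segment ℝ u v := by
    have := seg_comb (u := u) (v := v) (div_nonneg hb hS.le) (div_nonneg hc hS.le)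
      (by field_simp)
    convert this using 1
    rw [e, smul_add, smul_smul, smul_smul]
    congr 2 <;> ring
  obtain ⟨x, hx, hxX⟩ := hit_cevian hX h1 h2 hw
  have hinv : 0 < (b + c)⁻¹ := inv_pos.2 hS
  rcases le_or_gt (b + c)⁻¹ 1 with h | h
  · exact absurd ⟨x, seg_sub (seg_right _ _) (seg_ray_one hinv.le h) hx, hxX⟩ hd
  · refine ⟨x, hxX, ?_⟩
    obtain ⟨t, ht0, ht1, e1, e2⟩ := mem_seg.1 hx
    have ex : x = (1 - t + t * (b + c)⁻¹) • d := by
      ext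
      · simp at e1 ⊢; rw [e1]; ring
      · simp at e2 ⊢; rw [e2]; ring
    have h1' : 1 ≤ 1 - t + t * (b + c)⁻¹ := by nlinarith
    have := seg_ray_zero (d := d) zero_le_one h1'
    rwa [one_smul, ← ex] at this

/-- If `X` separates `d` from `u` and `v` but hides neither `d` nor `u` from the origin, then the origin
is not in the triangle `d u v`. -/
lemma not_surround {X : Set (ℝ × ℝ)} (hX : Convex ℝ X) {d u v : ℝ × ℝ} {b c : ℝ}
    (hb : 0 ≤ b) (hc : 0 ≤ c) (e : -d = b • u + c • v) (h1 : Hit X d u) (h2 : Hit X d v)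
    (hd : ¬ Hit X 0 d) (hu : ¬ Hit X 0 u) : False := by
  have hd0 : d ≠ 0 := hit_zero_right (hit_comm h1) hu
  have hS : 0 < b + c := by
    refine lt_of_le_of_ne (by linarith) fun h => hd0 ?_
    have hb0 : b = 0 := by linarith
    have hc0 : c = 0 := by linarith
    simpa [hb0, hc0] using e
  have hw : (-(b + c)⁻¹) • d ∈ segment ℝ u v := by
    have := seg_comb (u := u) (v := v) (div_nonneg hb hS.le) (div_nonneg hc hS.le)
      (by field_simp)
    convert this using 1
    rw [neg_smul, ← smul_neg, e, smul_add, smul_smul, smul_smul]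
    congr 2 <;> ring
  obtain ⟨x, hx, hxX⟩ := hit_cevian hX h1 h2 hw
  have hinv : 0 < (b + c)⁻¹ := inv_pos.2 hS
  obtain ⟨t, ht0, ht1, e1, e2⟩ := mem_seg.1 hx
  have ex : x = (1 - t - t * (b + c)⁻¹) • d := by
    ext
    · simp at e1 ⊢; rw [e1]; ring
    · simp at e2 ⊢; rw [e2]; ring
  rcases le_or_gt 0 (1 - t - t * (b + c)⁻¹) with h | h
  · exact hd ⟨x, ex ▸ seg_ray_one h (by nlinarith), hxX⟩
  · refine hu (hit_of_shadow hX hxX (seg_symm ?_) h1)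
    have := seg_ray (d := d) h.le (zero_le_one (α := ℝ))
    rwa [← ex, zero_smul, one_smul] at this

/-- Of three points that are seen from the origin and pairwise hidden by `X`, one lies between
the origin and `X`. -/
lemma exists_inShadow {X : Set (ℝ × ℝ)} (hX : Convex ℝ X) {d₁ d₂ d₃ : ℝ × ℝ}
    (s₁ : ¬ Hit X 0 d₁) (s₂ : ¬ Hit X 0 d₂) (s₃ : ¬ Hit X 0 d₃)
    (h₁₂ : Hit X d₁ d₂) (h₁₃ : Hit X d₁ d₃) (h₂₃ : Hit X d₂ d₃) :
    InShadow X d₁ ∨ InShadow X d₂ ∨ InShadow X d₃ := by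
  have n12 := det_ne_zero_of_hit h₁₂ s₁ s₂
  have n13 := det_ne_zero_of_hit h₁₃ s₁ s₃
  have n23 := det_ne_zero_of_hit h₂₃ s₂ s₃
  -- by Cramer's rule, the signs of the determinants say which point lies in the cone of the others
  have an : ∀ x y : ℝ × ℝ, det y x = - det x y := fun x y => by unfold det; ring
  have c1 := cramer d₁ n23
  have c2 := cramer d₂ n13
  have c3 := cramer d₃ n12
  have a12 := an d₁ d₂
  have a13 := an d₁ d₃
  have a23 := an d₂ d₃
  rcases lt_or_gt_of_ne n12 with p12 | p12 <;> rcases lt_or_gt_of_ne n13 with p13 | p13 <;>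
    rcases lt_or_gt_of_ne n23 with p23 | p23
  · exact Or.inr (Or.inl (inShadow_of_cone hX (div_nonneg_of_nonpos (by linarith) p13.le)
      (div_nonneg_of_nonpos (by linarith) p13.le) c2 (hit_comm h₁₂) h₂₃ s₂ s₁))
  · exact Or.inr (Or.inr (inShadow_of_cone hX (div_nonneg_of_nonpos (by linarith) p12.le)
      (div_nonneg_of_nonpos (by linarith) p12.le) c3 (hit_comm h₁₃) (hit_comm h₂₃) s₃ s₁))
  · exfalso
    refine not_surround hX (b := -(det d₁ d₃ / det d₂ d₃)) (c := -(det d₂ d₁ / det d₂ d₃))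
      ?_ ?_ (by rw [neg_smul, neg_smul, ← neg_add, ← c1]) h₁₂ h₁₃ s₁ s₂
    · exact neg_nonneg.2 (div_nonpos_of_nonneg_of_nonpos p13.le p23.le)
    · exact neg_nonneg.2 (div_nonpos_of_nonneg_of_nonpos (by linarith) p23.le)
  · exact Or.inl (inShadow_of_cone hX (div_nonneg (by linarith) p23.le)
      (div_nonneg (by linarith) p23.le) c1 h₁₂ h₁₃ s₁ s₂)
  · exact Or.inl (inShadow_of_cone hX (div_nonneg_of_nonpos (by linarith) p23.le)
      (div_nonneg_of_nonpos (by linarith) p23.le) c1 h₁₂ h₁₃ s₁ s₂)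
  · exfalso
    refine not_surround hX (b := -(det d₁ d₃ / det d₂ d₃)) (c := -(det d₂ d₁ / det d₂ d₃))
      ?_ ?_ (by rw [neg_smul, neg_smul, ← neg_add, ← c1]) h₁₂ h₁₃ s₁ s₂
    · exact neg_nonneg.2 (div_nonpos_of_nonpos_of_nonneg p13.le p23.le)
    · exact neg_nonneg.2 (div_nonpos_of_nonpos_of_nonneg (by linarith) p23.le)
  · exact Or.inr (Or.inr (inShadow_of_cone hX (div_nonneg (by linarith) p12.le)
      (div_nonneg (by linarith) p12.le) c3 (hit_comm h₁₃) (hit_comm h₂₃) s₃ s₁))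
  · exact Or.inr (Or.inl (inShadow_of_cone hX (div_nonneg (by linarith) p13.le)
      (div_nonneg (by linarith) p13.le) c2 (hit_comm h₁₂) h₂₃ s₂ s₁))

lemma inShadow_iff {X : Set (ℝ × ℝ)} {z : ℝ × ℝ} :
    InShadow X z ↔ ∃ x ∈ X, ∃ t : ℝ, 0 ≤ t ∧ t ≤ 1 ∧ z = t • x :=
  ⟨fun ⟨x, hx, h⟩ => ⟨x, hx, mem_seg_zero h⟩,
    fun ⟨x, hx, _, h0, h1, e⟩ => ⟨x, hx, e ▸ seg_ray_one h0 h1⟩⟩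

lemma inShadow_comb {X : Set (ℝ × ℝ)} (hX : Convex ℝ X) {u v : ℝ × ℝ} {a b : ℝ}
    (hu : InShadow X u) (hv : InShadow X v) (ha : 0 ≤ a) (hb : 0 ≤ b) (hab : a + b ≤ 1) :
    InShadow X (a • u + b • v) := by
  obtain ⟨x, hx, s, hs0, hs1, rfl⟩ := inShadow_iff.1 hu
  obtain ⟨y, hy, t, ht0, ht1, rfl⟩ := inShadow_iff.1 hv
  have h1 := mul_nonneg ha hs0
  have h2 := mul_nonneg hb ht0
  refine inShadow_iff.2 ?_
  rcases eq_or_lt_of_le (show 0 ≤ a * s + b * t by linarith) with h | h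
  · have e1 : a * s = 0 := by linarith
    have e2 : b * t = 0 := by linarith
    exact ⟨x, hx, 0, le_rfl, zero_le_one, by simp [smul_smul, e1, e2]⟩
  · refine ⟨_, hX hx hy (div_nonneg h1 h.le) (div_nonneg h2 h.le) (by field_simp),
      a * s + b * t, h.le, by nlinarith, ?_⟩
    rw [smul_add, smul_smul, smul_smul, smul_smul, smul_smul]
    congr 2 <;> field_simp

lemma eq_smul_of_det_eq_zero {y p : ℝ × ℝ} (hp : 0 < p.2) (h : det y p = 0) :
    y = (y.2 / p.2) • p := by
  unfold det at h
  ext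
  · simp; field_simp; linarith
  · simp; field_simp

lemma det_comb (a b : ℝ) (u v p : ℝ × ℝ) : det (a • u + b • v) p = a * det u p + b * det v p := by
  simp [det]; ring

lemma det_smul_left (a : ℝ) (u p : ℝ × ℝ) : det (a • u) p = a * det u p := by
  simp [det]; ring

lemma det_smul_right (a : ℝ) (u p : ℝ × ℝ) : det u (a • p) = a * det u p := by
  simp [det]; ring

lemma det_swap (u v : ℝ × ℝ) : det v u = - det u v := by simp [det]; ring

lemma det_self (u : ℝ × ℝ) : det u u = 0 := by simp [det]; ring

lemma exists_convex_zero {x y : ℝ} (hx : x ≤ 0) (hy : 0 ≤ y) :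
    ∃ t : ℝ, 0 ≤ t ∧ t ≤ 1 ∧ (1 - t) * x + t * y = 0 := by
  rcases eq_or_lt_of_le hx with h | h
  · exact ⟨0, le_rfl, zero_le_one, by simp [h]⟩
  · refine ⟨-x / (y - x), div_nonneg (by linarith) (by linarith), ?_, ?_⟩
    · rw [div_le_one (by linarith)]; linarith
    · have : y - x ≠ 0 := by linarith
      field_simp; ring

/-- A convex set that meets the region between the origin and `X` on both sides of the ray through
`p ∈ X` either meets `X` or crosses the segment from the origin to `p`. -/
lemma hit_of_shadow_both_sides {X Y : Set (ℝ × ℝ)} (hX : Convex ℝ X) (hpos : ∀ x ∈ X, 0 < x.2)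
    (hY : Convex ℝ Y) (hXY : Disjoint X Y) {y z p : ℝ × ℝ} (hy : y ∈ Y) (hz : z ∈ Y)
    (sy : InShadow X y) (sz : InShadow X z) (hp : p ∈ X) (dy : det y p ≤ 0) (dz : 0 ≤ det z p) :
    Hit Y 0 p := by
  obtain ⟨t, ht0, ht1, ht⟩ := exists_convex_zero dy dz
  have hw : (1 - t) • y + t • z ∈ Y := hY hy hz (by linarith) ht0 (by ring)
  have sw : InShadow X ((1 - t) • y + t • z) :=
    inShadow_comb hX sy sz (by linarith) ht0 (by linarith)
  have ew := eq_smul_of_det_eq_zero (hpos p hp) (by rw [det_comb, ht])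
  generalize (1 - t) • y + t • z = w at *
  obtain ⟨x, hx, s, hs0, hs1, e⟩ := inShadow_iff.1 sw
  have hp2 := hpos p hp
  have hx2 := hpos x hx
  have hw2 : w.2 = s * x.2 := by rw [e]; simp
  have hw0 : 0 ≤ w.2 / p.2 := div_nonneg (hw2 ▸ mul_nonneg hs0 hx2.le) hp2.le
  rcases le_or_gt (w.2 / p.2) 1 with h | h
  · exact ⟨w, ew ▸ seg_ray_one hw0 h, hw⟩
  · exfalso
    have hs : 0 < s := by
      rcases eq_or_lt_of_le hs0 with h' | h'
      · rw [← h', zero_mul] at hw2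
        rw [hw2, zero_div] at h
        linarith
      · exact h'
    have ex : x = (w.2 / p.2 / s) • p := by
      have : x = s⁻¹ • w := by rw [e, smul_smul, inv_mul_cancel₀ hs.ne', one_smul]
      rw [this, ew, smul_smul]
      congr 1
      simp; field_simp
    have : w ∈ segment ℝ p x := by
      have h2 := seg_ray (d := p) h.le (show w.2 / p.2 ≤ w.2 / p.2 / s by
        rw [le_div_iff₀ hs]; nlinarith)
      rwa [one_smul, ← ew, ← ex] at h2
    exact Set.disjoint_left.1 hXY (hX.segment_subset hp hx this) hw

/-- If `X` separates `u` from `v` and has points behind both, then a segment from `v` that misses `X`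
can reach the ray through `u` only at a point `m • u` of the segment from the origin to `u`. -/
lemma le_one_of_not_hit {X : Set (ℝ × ℝ)} (hX : Convex ℝ X) {a b u v : ℝ × ℝ} {m : ℝ}
    (ha : a ∈ X) (hb : b ∈ X) (hu : u ∈ segment ℝ 0 a) (hv : v ∈ segment ℝ 0 b)
    (h : Hit X u v) (hn : ¬ Hit X v (m • u)) : m ≤ 1 := by
  by_contra hm
  have hm := not_le.1 hm
  obtain ⟨t, ht0, ht1, rfl⟩ := mem_seg_zero hu
  rw [smul_smul] at hn
  rcases le_or_gt (m * t) 1 with h1 | h1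
  · have h2 := seg_ray (d := a) (show t ≤ m * t by nlinarith) h1
    rw [one_smul] at h2
    exact hn (hit_comm (hit_of_shadow hX ha h2 h))
  · have h2 := seg_ray_zero (d := a) zero_le_one h1.le
    rw [one_smul] at h2
    exact hn (hit_of_shadow hX hb hv ⟨a, h2, ha⟩)

/-- A segment that starts inside the cone spanned by `u` and `v` and ends outside it passes
through one of the two boundary rays. -/
lemma exists_exit {u v d e : ℝ × ℝ} (hu : 0 < u.2) (hv : 0 < v.2) (huv : det u v < 0)
    (h1 : det u d < 0) (h2 : det d v < 0) (he : 0 < det u e ∨ 0 < det e v) :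
    ∃ p ∈ segment ℝ d e, ∃ m : ℝ, 0 ≤ m ∧ (p = m • u ∨ p = m • v) := by
  have su : ∀ p : ℝ × ℝ, det u p = 0 → det p v ≤ 0 → ∃ m : ℝ, 0 ≤ m ∧ p = m • u := by
    intro p hp hpv
    have e := eq_smul_of_det_eq_zero hu (by rw [det_swap, hp, neg_zero])
    refine ⟨_, ?_, e⟩
    by_contra hm
    rw [e, det_smul_left] at hpv
    nlinarith
  have sv : ∀ p : ℝ × ℝ, det p v = 0 → det u p ≤ 0 → ∃ m : ℝ, 0 ≤ m ∧ p = m • v := by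
    intro p hp hpv
    have e := eq_smul_of_det_eq_zero hv hp
    refine ⟨_, ?_, e⟩
    by_contra hm
    rw [e, det_smul_right] at hpv
    nlinarith
  have lu : ∀ t : ℝ, det u ((1 - t) • d + t • e) = (1 - t) * det u d + t * det u e := by
    intro t; simp [det]; ring
  have lv : ∀ t : ℝ, det ((1 - t) • d + t • e) v = (1 - t) * det d v + t * det e v := by
    intro t; simp [det]; ring
  have mem : ∀ t : ℝ, 0 ≤ t → t ≤ 1 → (1 - t) • d + t • e ∈ segment ℝ d e := fun t h0 h1 =>
    seg_comb (by linarith) h0 (by ring)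
  -- the first of the two exit times is the right one
  by_cases hu' : 0 ≤ det u e
  · obtain ⟨t, ht0, ht1, ht⟩ := exists_convex_zero h1.le hu'
    by_cases hc : det ((1 - t) • d + t • e) v ≤ 0
    · obtain ⟨m, hm, e⟩ := su _ (by rw [lu, ht]) hc
      exact ⟨_, mem t ht0 ht1, m, hm, Or.inl e⟩
    · have hc := not_le.1 hc
      rw [lv] at hc
      obtain ⟨s, hs0, hs1, hs⟩ := exists_convex_zero h2.le hc.le
      have hst : s * t ≤ t := by nlinarith
      obtain ⟨m, hm, e⟩ := sv ((1 - s * t) • d + (s * t) • e)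
        (by rw [lv]; linear_combination hs) (by rw [lu]; nlinarith)
      exact ⟨_, mem _ (mul_nonneg hs0 ht0) (by linarith), m, hm, Or.inr e⟩
  · have hv' : 0 < det e v := he.resolve_left fun h => hu' h.le
    obtain ⟨t, ht0, ht1, ht⟩ := exists_convex_zero h2.le hv'.le
    obtain ⟨m, hm, e⟩ := sv _ (by rw [lv, ht]) (by rw [lu]; nlinarith)
    exact ⟨_, mem t ht0 ht1, m, hm, Or.inr e⟩

/-- Two segments have a common point. -/
def Cross (a b c d : ℝ × ℝ) : Prop := ∃ p ∈ segment ℝ a b, p ∈ segment ℝ c d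

/-- A segment from `d` to a point of the ray through `u` crosses every ray `w` in between. -/
lemma exists_ray_between {u w d p : ℝ × ℝ} {l : ℝ} (hw : 0 < w.2) (hu : 0 < u.2) (hd : 0 < d.2)
    (hl : 0 ≤ l) (hp : p = l • u) (h : det u w * det w d ≥ 0) :
    ∃ q ∈ segment ℝ d p, ∃ m : ℝ, 0 ≤ m ∧ q = m • w := by
  have key : ∃ t : ℝ, 0 ≤ t ∧ t ≤ 1 ∧ (1 - t) * det d w + t * det p w = 0 := by
    rcases le_total (det d w) 0 with h1 | h1
    · rcases eq_or_lt_of_le h1 with h2 | h2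
      · exact ⟨0, le_rfl, zero_le_one, by simp [h2]⟩
      · refine exists_convex_zero h1 ?_
        rw [hp, det_smul_left]
        refine mul_nonneg hl ?_
        rw [det_swap d w] at h
        nlinarith
    · rcases eq_or_lt_of_le h1 with h2 | h2
      · exact ⟨0, le_rfl, zero_le_one, by simp [← h2]⟩
      · have h3 : det p w ≤ 0 := by
          rw [hp, det_smul_left]
          refine mul_nonpos_of_nonneg_of_nonpos hl ?_
          rw [det_swap d w] at h
          nlinarith
        obtain ⟨t, h0, h1, h2⟩ := exists_convex_zero (neg_nonpos.2 h1) (neg_nonneg.2 h3)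
        exact ⟨t, h0, h1, by linarith⟩
  obtain ⟨t, h0, h1, ht⟩ := key
  refine ⟨(1 - t) • d + t • p, seg_comb (by linarith) h0 (by ring), _, ?_,
    eq_smul_of_det_eq_zero hw (by rw [det_comb, ht])⟩
  refine div_nonneg ?_ hw.le
  have : p.2 = l * u.2 := by rw [hp]; simp
  have h3 := mul_nonneg (sub_nonneg.2 h1) hd.le
  have h4 := mul_nonneg h0 (mul_nonneg hl hu.le)
  simp [this]; linarith

/-! ### Sorted stars -/

/-- Let points `d i = t i • a i` with `a i ∈ X` be sorted by slope and pairwise hidden by `X`. Then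
every other obstacle meets the fan of at most one of three consecutive blocks, and in a free block
a segment from `d i` to a point hidden from the origin by another obstacle leaves the fan sideways,
crossing all spokes on one side. -/
lemma exists_free_block {κ : Type*} {X : Set (ℝ × ℝ)} (hX : Convex ℝ X) (hpos : ∀ x ∈ X, 0 < x.2)
    {Y : κ → Set (ℝ × ℝ)} (hY : ∀ k, Convex ℝ (Y k)) (hXY : ∀ k, Disjoint X (Y k))
    (hκ : ∀ f : Fin 3 → κ, ¬ Function.Injective f)
    {n : ℕ} {a d : ℕ → ℝ × ℝ} {t : ℕ → ℝ}
    (ha : ∀ i < 3 * (n + 2), a i ∈ X) (ht : ∀ i < 3 * (n + 2), 0 < t i ∧ t i ≤ 1)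
    (hd : ∀ i, d i = t i • a i) (hYa : ∀ i < 3 * (n + 2), ∀ k, ¬ Hit (Y k) 0 (a i))
    (hdd : ∀ i < 3 * (n + 2), ∀ j < 3 * (n + 2), i ≠ j → Hit X (d i) (d j))
    (hord : ∀ i j, i < j → j < 3 * (n + 2) → det (a i) (a j) < 0) :
    ∃ s, s + (n + 2) ≤ 3 * (n + 2) ∧ ∀ i, 0 < i → i < n + 1 → ∀ e, ¬ Hit X (d (s + i)) e →
      (∃ k, Hit (Y k) 0 e) →
      (∀ m < i, Cross (d (s + i)) e 0 (d (s + m))) ∨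
      (∀ m, i < m → m < n + 2 → Cross (d (s + i)) e 0 (d (s + m))) := by
  have sa : ∀ i < 3 * (n + 2), InShadow X (a i) := fun i hi => ⟨a i, ha i hi, seg_right _ _⟩
  have nlt : ∀ i j, i ≤ j → j < 3 * (n + 2) → det (a i) (a j) ≤ 0 := by
    intro i j hij hj
    rcases Nat.eq_or_lt_of_le hij with rfl | h
    · rw [det_self]
    · exact (hord i j h hj).le
  -- a free block
  have hfree : ∃ b : Fin 3, ∀ k, ∀ y ∈ Y k, ∀ α β : ℝ, 0 ≤ α → 0 ≤ β → α + β ≤ 1 →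
      y ≠ α • a (b * (n + 2)) + β • a (b * (n + 2) + (n + 1)) := by
    by_contra hcon
    push Not at hcon
    choose f y hy α β hα hβ hαβ e using hcon
    refine hκ f fun b c hbc => ?_
    have main : ∀ b c : Fin 3, b < c → f b ≠ f c := by
      intro b c hlt hf
      have hb := b.2
      have hc := c.2
      have hlt' : (b : ℕ) + 1 ≤ c := hlt
      have h1 : (b : ℕ) * (n + 2) + (n + 1) < (c : ℕ) * (n + 2) := by nlinarith
      have h2 : (c : ℕ) * (n + 2) + (n + 1) < 3 * (n + 2) := by
        have : (c : ℕ) + 1 ≤ 3 := hc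
        nlinarith
      refine hYa _ (h1.trans ((Nat.le_add_right _ _).trans_lt h2)) (f b)
        (hit_of_shadow_both_sides hX hpos (hY _) (hXY _) (hy b) (hf ▸ hy c) ?_ ?_
          (ha _ (h1.trans ((Nat.le_add_right _ _).trans_lt h2))) ?_ ?_)
      · rw [e b]
        exact inShadow_comb hX (sa _ (by omega)) (sa _ (by omega)) (hα b) (hβ b) (hαβ b)
      · rw [e c]
        exact inShadow_comb hX (sa _ (by omega)) (sa _ (by omega)) (hα c) (hβ c) (hαβ c)
      · rw [e b, det_comb, det_self, mul_zero, add_zero]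
        exact mul_nonpos_of_nonneg_of_nonpos (hα b) (nlt _ _ (by omega) (by omega))
      · rw [e c, det_comb, det_swap (a (b * (n + 2) + (n + 1))),
          det_swap (a (b * (n + 2) + (n + 1)))]
        have := nlt (b * (n + 2) + (n + 1)) (c * (n + 2)) (by omega) (by omega)
        have := nlt (b * (n + 2) + (n + 1)) (c * (n + 2) + (n + 1)) (by omega) (by omega)
        exact add_nonneg (mul_nonneg (hα c) (by linarith)) (mul_nonneg (hβ c) (by linarith))
    rcases lt_trichotomy b c with h | h | h
    · exact absurd hbc (main b c h)
    · exact h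
    · exact absurd hbc.symm (main c b h)
  obtain ⟨b, hb⟩ := hfree
  have hb3 : (b : ℕ) * (n + 2) + (n + 2) ≤ 3 * (n + 2) := by
    have : (b : ℕ) + 1 ≤ 3 := b.2
    nlinarith
  generalize (b : ℕ) * (n + 2) = s at hb hb3
  refine ⟨s, hb3, fun i hi hin e hXe ⟨k, hk⟩ => ?_⟩
  have hti := ht (s + i) (by omega)
  have p : ∀ j < 3 * (n + 2), 0 < (a j).2 := fun j hj => hpos _ (ha j hj)
  have hdi : ∀ j < 3 * (n + 2), d j ∈ segment ℝ 0 (a j) := fun j hj =>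
    hd j ▸ seg_ray_one (ht j hj).1.le (ht j hj).2
  have huv := hord s (s + (n + 1)) (by omega) (by omega)
  have hout : 0 < det (a s) e ∨ 0 < det e (a (s + (n + 1))) := by
    by_contra hcon
    push Not at hcon
    obtain ⟨h1, h2⟩ := hcon
    have he := cramer e huv.ne
    have hα := div_nonneg_of_nonpos h2 huv.le
    have hβ := div_nonneg_of_nonpos h1 huv.le
    generalize det e (a (s + (n + 1))) / det (a s) (a (s + (n + 1))) = α at *
    generalize det (a s) e / det (a s) (a (s + (n + 1))) = β at *
    rcases le_or_gt (α + β) 1 with h | h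
    · obtain ⟨y, hy, hyY⟩ := hk
      obtain ⟨r, hr0, hr1, rfl⟩ := mem_seg_zero hy
      refine hb k _ hyY (r * α) (r * β) (mul_nonneg hr0 hα) (mul_nonneg hr0 hβ) (by nlinarith) ?_
      rw [he, smul_add, smul_smul, smul_smul]
    · have hx : (α + β)⁻¹ • e ∈ X := by
        have := hX (ha s (by omega)) (ha (s + (n + 1)) (by omega))
          (div_nonneg hα (by linarith : 0 ≤ α + β)) (div_nonneg hβ (by linarith : 0 ≤ α + β))
          (by field_simp)
        convert this using 1
        rw [he, smul_add, smul_smul, smul_smul]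
        congr 2 <;> ring
      refine hXe (hit_of_shadow hX (ha (s + i) (by omega)) (hdi _ (by omega)) ⟨_, ?_, hx⟩)
      exact seg_ray_one (inv_nonneg.2 (by linarith)) (inv_le_one_of_one_le₀ h.le)
  obtain ⟨q, hq, m, hm, hqm⟩ := exists_exit (d := d (s + i)) (e := e) (p s (by omega))
    (p (s + (n + 1)) (by omega)) huv
    (by rw [hd, det_smul_right]; exact mul_neg_of_pos_of_neg hti.1 (hord _ _ (by omega) (by omega)))
    (by rw [hd, det_smul_left]; exact mul_neg_of_pos_of_neg hti.1 (hord _ _ (by omega) (by omega)))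
    hout
  have hd2 : 0 < (d (s + i)).2 := by
    rw [hd]; simpa using mul_pos hti.1 (p _ (by omega))
  have fin : ∀ j < 3 * (n + 2), j ≠ s + i → ∀ w ∈ segment ℝ (d (s + i)) q, ∀ r : ℝ, 0 ≤ r →
      w = r • a j → Cross (d (s + i)) e 0 (d j) := by
    intro j hj hji w hw r hr hwr
    have hwe := seg_sub (seg_left _ _) hq hw
    refine ⟨w, hwe, ?_⟩
    have htj := (ht j hj).1
    have ew : w = (r / t j) • d j := by
      rw [hwr, hd j, smul_smul]
      congr 1
      field_simp
    rw [ew]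
    refine seg_ray_one (div_nonneg hr htj.le) (le_one_of_not_hit hX (ha j hj)
      (ha (s + i) (by omega)) (hdi j hj) (hdi _ (by omega)) (hdd j hj _ (by omega) hji) ?_)
    rw [← ew]
    exact fun h => hXe (h.mono (seg_left _ _) hwe)
  rcases hqm with hqm | hqm
  · left
    intro j hj
    obtain ⟨w, hw, r, hr, hwr⟩ := exists_ray_between (w := a (s + j)) (p _ (by omega))
      (p s (by omega)) hd2 hm hqm (by
        have h1 := nlt s (s + j) (by omega) (by omega)
        have h2 := hord (s + j) (s + i) (by omega) (by omega)
        rw [hd, det_smul_right]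
        exact mul_nonneg_of_nonpos_of_nonpos h1
          (mul_nonpos_of_nonneg_of_nonpos hti.1.le h2.le))
    exact fin (s + j) (by omega) (by omega) w hw r hr hwr
  · right
    intro j hj hjn
    obtain ⟨w, hw, r, hr, hwr⟩ := exists_ray_between (w := a (s + j)) (p _ (by omega))
      (p (s + (n + 1)) (by omega)) hd2 hm hqm (by
        have h1 := nlt (s + j) (s + (n + 1)) (by omega) (by omega)
        have h2 := hord (s + i) (s + j) (by omega) (by omega)
        rw [hd, det_smul_right, det_swap, det_swap (a (s + i))]
        exact mul_nonneg (by linarith) (mul_nonneg hti.1.le (by linarith)))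
    exact fin (s + j) (by omega) (by omega) w hw r hr hwr

lemma mem_seg_of_not_mem {a b d : ℝ × ℝ} (hb : b ∈ segment ℝ 0 a) (hd : d ∈ segment ℝ 0 a)
    (h : b ∉ segment ℝ 0 d) : b ∈ segment ℝ d a := by
  obtain ⟨s, hs0, hs1, rfl⟩ := mem_seg_zero hb
  obtain ⟨t, ht0, ht1, rfl⟩ := mem_seg_zero hd
  rcases le_total s t with h1 | h1
  · exact absurd (seg_ray_zero hs0 h1) h
  · have := seg_ray (d := a) h1 hs1
    rwa [one_smul] at this

/-- The points `d i`, `i ∈ S`, contain `n` points that are sorted by angle as seen from `o`, each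
lying between `o` and a point `a` of the obstacle `X` such that none of the other obstacles `Y k`
reaches between `o` and `a`; and every segment from such a point to a point that is hidden from
`o` by some `Y k` but not hidden from its starting point by `X` crosses all the segments from `o`
to the earlier points, or all those to the later points. -/
def SortedFan {ι κ : Type*} (o : ℝ × ℝ) (X : Set (ℝ × ℝ)) (Y : κ → Set (ℝ × ℝ)) (S : Finset ι)
    (d : ι → ℝ × ℝ) (n : ℕ) : Prop :=
  ∃ f : Fin n → ι, Function.Injective f ∧ (∀ i, f i ∈ S) ∧
    (∀ i, ∃ a ∈ X, d (f i) ∈ segment ℝ o a ∧ ∀ k, ¬ Hit (Y k) o a) ∧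
    (∀ l m r : Fin n, l < m → m < r → ∃ α β : ℝ, 0 ≤ α ∧ 0 ≤ β ∧
      d (f m) - o = α • (d (f l) - o) + β • (d (f r) - o)) ∧
    ∀ i e, ¬ Hit X (d (f i)) e → (∃ k, Hit (Y k) o e) →
      (∀ m < i, Cross (d (f i)) e o (d (f m))) ∨ (∀ m, i < m → Cross (d (f i)) e o (d (f m)))

lemma exists_sorted {ι : Type*} {S : Finset ι} {N : ℕ} (hN : 0 < N) (h : N ≤ S.card) {s : ι → ℝ}
    (hs : ∀ i ∈ S, ∀ j ∈ S, i ≠ j → s i ≠ s j) :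
    ∃ g : ℕ → ι, (∀ i, g i ∈ S) ∧ ∀ i j, i < j → j < N → s (g i) < s (g j) := by
  classical
  have hc : N ≤ (S.image s).card := by
    rw [Finset.card_image_of_injOn]
    · exact h
    · intro i hi j hj hij
      by_contra hne
      exact hs i hi j hj hne hij
  have hmem := fun i => Finset.mem_image.1 (Finset.orderEmbOfCardLe_mem (S.image s) hc i)
  choose g hg hgs using hmem
  refine ⟨fun i => g ⟨i % N, Nat.mod_lt _ hN⟩, fun i => hg _, fun i j hij hj => ?_⟩
  rw [hgs, hgs]
  refine (Finset.orderEmbOfCardLe (S.image s) hc).strictMono ?_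
  simp only [Fin.mk_lt_mk]
  rwa [Nat.mod_eq_of_lt (hij.trans hj), Nat.mod_eq_of_lt hj]

/-- The existence of sorted fans, in coordinates in which the centre is the origin and `X` lies in the
upper half-plane. At most two points are not in the shadow of `X`, and each `Y k` reaches between
at most one other point and `X`; of the rest, sorted by slope, a block is taken that no `Y k`
meets. -/
lemma sortedFan_zero {ι : Type*} {X : Set (ℝ × ℝ)} (hX : Convex ℝ X) (hpos : ∀ x ∈ X, 0 < x.2)
    {Y : Fin 2 → Set (ℝ × ℝ)} (hY : ∀ k, Convex ℝ (Y k)) (hXY : ∀ k, Disjoint X (Y k))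
    {n : ℕ} {S : Finset ι} (hS : 3 * (n + 2) + 4 ≤ S.card) {d : ι → ℝ × ℝ}
    (hd : ∀ i ∈ S, ¬ Hit X 0 (d i)) (hYd : ∀ i ∈ S, ∀ k, ¬ Hit (Y k) 0 (d i))
    (hdd : ∀ i ∈ S, ∀ j ∈ S, i ≠ j → Hit X (d i) (d j)) : SortedFan 0 X Y S d n := by
  classical
  have hbad : (S.filter fun i => ¬ InShadow X (d i)).card ≤ 2 := by
    by_contra hcon
    obtain ⟨i, j, k, hi, hj, hk, hij, hik, hjk⟩ := Finset.two_lt_card_iff.1 (not_le.1 hcon)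
    simp only [Finset.mem_filter] at hi hj hk
    rcases exists_inShadow hX (hd i hi.1) (hd j hj.1) (hd k hk.1) (hdd i hi.1 j hj.1 hij)
      (hdd i hi.1 k hk.1 hik) (hdd j hj.1 k hk.1 hjk) with h | h | h
    · exact hi.2 h
    · exact hj.2 h
    · exact hk.2 h
  have hch : ∀ i, ∃ a, InShadow X (d i) → a ∈ X ∧ d i ∈ segment ℝ 0 a := by
    intro i
    by_cases h : InShadow X (d i)
    · obtain ⟨a, ha, h'⟩ := h
      exact ⟨a, fun _ => ⟨ha, h'⟩⟩
    · exact ⟨0, fun h' => absurd h' h⟩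
  choose a ha using hch
  set S' := S.filter fun i => InShadow X (d i) with hS'
  have hbad' : ∀ k, (S'.filter fun i => Hit (Y k) 0 (a i)).card ≤ 1 := by
    intro k
    rw [Finset.card_le_one]
    intro i hi j hj
    simp only [hS', Finset.mem_filter] at hi hj
    obtain ⟨⟨hiS, hi⟩, y, hy, hyY⟩ := hi
    obtain ⟨⟨hjS, hj⟩, z, hz, hzY⟩ := hj
    by_contra hne
    have h1 := mem_seg_of_not_mem hy (ha i hi).2 fun h => hYd i hiS k ⟨y, h, hyY⟩
    have h2 := mem_seg_of_not_mem hz (ha j hj).2 fun h => hYd j hjS k ⟨z, h, hzY⟩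
    obtain ⟨x, hx, hxX⟩ := hit_of_shadow hX (ha j hj).1 h2
      (hit_comm (hit_of_shadow hX (ha i hi).1 h1 (hdd i hiS j hjS hne)))
    exact Set.disjoint_left.1 (hXY k) hxX ((hY k).segment_subset hzY hyY hx)
  set S'' := S'.filter fun i => ∀ k, ¬ Hit (Y k) 0 (a i) with hS''
  have hcard : 3 * (n + 2) ≤ S''.card := by
    have hsub : S ⊆ S'' ∪ (S.filter fun i => ¬ InShadow X (d i)) ∪
        (S'.filter fun i => Hit (Y 0) 0 (a i)) ∪ (S'.filter fun i => Hit (Y 1) 0 (a i)) := by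
      intro i hi
      simp only [hS'', hS', Finset.mem_union, Finset.mem_filter, Fin.forall_fin_two]
      tauto
    have := Finset.card_le_card hsub
    have := Finset.card_union_le (S'' ∪ (S.filter fun i => ¬ InShadow X (d i)) ∪
        (S'.filter fun i => Hit (Y 0) 0 (a i))) (S'.filter fun i => Hit (Y 1) 0 (a i))
    have := Finset.card_union_le (S'' ∪ (S.filter fun i => ¬ InShadow X (d i)))
        (S'.filter fun i => Hit (Y 0) 0 (a i))
    have := Finset.card_union_le S'' (S.filter fun i => ¬ InShadow X (d i))
    have := hbad' 0
    have := hbad' 1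
    omega
  have hmem : ∀ i ∈ S'', i ∈ S ∧ (a i ∈ X ∧ d i ∈ segment ℝ 0 (a i)) ∧
      ∀ k, ¬ Hit (Y k) 0 (a i) := by
    intro i hi
    simp only [hS'', hS', Finset.mem_filter] at hi
    exact ⟨hi.1.1, ha i hi.1.2, hi.2⟩
  have ht : ∀ i, ∃ t : ℝ, i ∈ S'' → 0 < t ∧ t ≤ 1 ∧ d i = t • a i := by
    intro i
    by_cases h : i ∈ S''
    · obtain ⟨t, ht0, ht1, e⟩ := mem_seg_zero (hmem i h).2.1.2
      refine ⟨t, fun _ => ⟨lt_of_le_of_ne ht0 ?_, ht1, e⟩⟩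
      rintro rfl
      -- two points of `S''` are needed to see that no `d i` is the origin
      obtain ⟨j, hj, hji⟩ := Finset.exists_mem_ne (by omega : 1 < S''.card) i
      refine hd j (hmem j hj).1 ?_
      have := hdd i (hmem i h).1 j (hmem j hj).1 hji.symm
      rwa [e, zero_smul] at this
    · exact ⟨0, fun h' => absurd h' h⟩
  choose t ht using ht
  have hslope : ∀ i ∈ S'', ∀ j ∈ S'', i ≠ j → (a i).1 / (a i).2 ≠ (a j).1 / (a j).2 := by
    intro i hi j hj hne h
    have hi' := hmem i hi
    have hj' := hmem j hj
    have hdet := det_ne_zero_of_hit (hdd i hi'.1 j hj'.1 hne) (hd i hi'.1) (hd j hj'.1)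
    rw [div_eq_div_iff (hpos _ hi'.2.1.1).ne' (hpos _ hj'.2.1.1).ne'] at h
    apply hdet
    rw [(ht i hi).2.2, (ht j hj).2.2, det_smul_left, det_smul_right]
    unfold det
    rw [h]; ring
  obtain ⟨g, hg, hgs⟩ := exists_sorted (by omega) hcard hslope
  have hord : ∀ i j, i < j → j < 3 * (n + 2) → det (a (g i)) (a (g j)) < 0 := by
    intro i j hij hj
    have h := hgs i j hij hj
    rw [div_lt_div_iff₀ (hpos _ (hmem _ (hg i)).2.1.1) (hpos _ (hmem _ (hg j)).2.1.1)] at h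
    unfold det
    linarith
  have hne : ∀ i < 3 * (n + 2), ∀ j < 3 * (n + 2), i ≠ j → g i ≠ g j := by
    intro i hi j hj hij h
    rcases lt_or_gt_of_ne hij with h' | h'
    · exact (hgs i j h' hj).ne (by rw [h])
    · exact (hgs j i h' hi).ne (by rw [h])
  obtain ⟨s, hs, hfree⟩ := exists_free_block hX hpos hY hXY
    (fun f hf => by simpa using Fintype.card_le_of_injective f hf)
    (n := n) (a := fun i => a (g i)) (d := fun i => d (g i)) (t := fun i => t (g i))
    (fun i _ => (hmem _ (hg i)).2.1.1)
    (fun i _ => ⟨(ht _ (hg i)).1, (ht _ (hg i)).2.1⟩) (fun i => (ht _ (hg i)).2.2)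
    (fun i _ => (hmem _ (hg i)).2.2)
    (fun i hi j hj hij => hdd _ (hmem _ (hg i)).1 _ (hmem _ (hg j)).1 (hne i hi j hj hij)) hord
  refine ⟨fun i => g (s + (i + 1)), ?_, fun i => (hmem _ (hg _)).1, ?_, ?_, ?_⟩
  · intro i j hij
    by_contra h
    have h' : (i : ℕ) ≠ j := fun h' => h (Fin.ext h')
    exact hne (s + (i + 1)) (by omega) (s + (j + 1)) (by omega) (by omega) hij
  · exact fun i => ⟨_, (hmem _ (hg _)).2.1.1, (hmem _ (hg _)).2.1.2, (hmem _ (hg _)).2.2⟩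
  · intro l m r hlm hmr
    have hlm' : (l : ℕ) < m := hlm
    have hmr' : (m : ℕ) < r := hmr
    have e : ∀ i j : Fin n, det (d (g (s + (i + 1)))) (d (g (s + (j + 1)))) =
        t (g (s + (i + 1))) * (t (g (s + (j + 1))) *
          det (a (g (s + (i + 1)))) (a (g (s + (j + 1))))) := by
      intro i j
      rw [(ht _ (hg _)).2.2, (ht (g (s + (j + 1))) (hg _)).2.2, det_smul_left, det_smul_right]
    have ne : ∀ i j : Fin n, i < j →
        det (d (g (s + (i + 1)))) (d (g (s + (j + 1)))) < 0 := by
      intro i j hij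
      have hij' : (i : ℕ) < j := hij
      rw [e]
      exact mul_neg_of_pos_of_neg (ht _ (hg _)).1
        (mul_neg_of_pos_of_neg (ht _ (hg _)).1 (hord _ _ (by omega) (by omega)))
    refine ⟨_, _, div_nonneg_of_nonpos (ne m r hmr).le (ne l r (hlm.trans hmr)).le,
      div_nonneg_of_nonpos (ne l m hlm).le (ne l r (hlm.trans hmr)).le, ?_⟩
    rw [sub_zero, sub_zero, sub_zero]
    exact cramer _ (ne l r (hlm.trans hmr)).ne
  · intro i e h1 h2
    rcases hfree (i + 1) (by omega) (by omega) e h1 h2 with h | h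
    · exact Or.inl fun m hm => h (m + 1) (by have : (m : ℕ) < i := hm; omega)
    · exact Or.inr fun m hm => h (m + 1) (by have : (i : ℕ) < m := hm; omega) (by omega)

/-! ### Affine changes of coordinates -/

lemma mem_seg_map (F : (ℝ × ℝ) ≃ᵃ[ℝ] (ℝ × ℝ)) {p q x : ℝ × ℝ} :
    F x ∈ segment ℝ (F p) (F q) ↔ x ∈ segment ℝ p q := by
  have := image_segment ℝ (F : (ℝ × ℝ) →ᵃ[ℝ] (ℝ × ℝ)) p q
  simp only [AffineEquiv.coe_toAffineMap] at this
  erw [← this]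
  exact F.injective.mem_set_image

lemma hit_map (F : (ℝ × ℝ) ≃ᵃ[ℝ] (ℝ × ℝ)) {X : Set (ℝ × ℝ)} {p q : ℝ × ℝ} :
    Hit (F '' X) (F p) (F q) ↔ Hit X p q := by
  constructor
  · rintro ⟨_, hx, x, hxX, rfl⟩
    exact ⟨x, (mem_seg_map F).1 hx, hxX⟩
  · rintro ⟨x, hx, hxX⟩
    exact ⟨F x, (mem_seg_map F).2 hx, x, hxX, rfl⟩

lemma cross_map (F : (ℝ × ℝ) ≃ᵃ[ℝ] (ℝ × ℝ)) {a b c d : ℝ × ℝ} :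
    Cross (F a) (F b) (F c) (F d) ↔ Cross a b c d := by
  constructor
  · rintro ⟨x, hx, hx'⟩
    obtain ⟨y, rfl⟩ := F.surjective x
    exact ⟨y, (mem_seg_map F).1 hx, (mem_seg_map F).1 hx'⟩
  · rintro ⟨x, hx, hx'⟩
    exact ⟨F x, (mem_seg_map F).2 hx, (mem_seg_map F).2 hx'⟩

lemma convex_map (F : (ℝ × ℝ) ≃ᵃ[ℝ] (ℝ × ℝ)) {X : Set (ℝ × ℝ)} (h : Convex ℝ X) :
    Convex ℝ (F '' X) :=
  h.affine_image (F : (ℝ × ℝ) →ᵃ[ℝ] (ℝ × ℝ))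

lemma exists_affineEquiv (o : ℝ × ℝ) {a b c d : ℝ} (h : a * d - b * c ≠ 0) :
    ∃ F : (ℝ × ℝ) ≃ᵃ[ℝ] (ℝ × ℝ), ∀ x, F x =
      (a * (x.1 - o.1) + b * (x.2 - o.2), c * (x.1 - o.1) + d * (x.2 - o.2)) := by
  have hi := inv_mul_cancel₀ h
  generalize (a * d - b * c)⁻¹ = i at hi
  let L : (ℝ × ℝ) ≃ₗ[ℝ] (ℝ × ℝ) :=
    { toFun := fun x => (a * x.1 + b * x.2, c * x.1 + d * x.2)
      invFun := fun y => (i * (d * y.1 - b * y.2), i * (a * y.2 - c * y.1))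
      map_add' := fun x y => by ext <;> simp <;> ring
      map_smul' := fun r x => by ext <;> simp <;> ring
      left_inv := fun x => by
        ext
        · simp; linear_combination x.1 * hi
        · simp; linear_combination x.2 * hi
      right_inv := fun x => by
        ext
        · simp; linear_combination x.1 * hi
        · simp; linear_combination x.2 * hi }
  refine ⟨(AffineEquiv.constVAdd ℝ (ℝ × ℝ) (-o)).trans L.toAffineEquiv, fun x => ?_⟩
  ext <;> simp [L] <;> ring

/-- Coordinates in which a closed convex set that misses `o` lies in the upper half-plane and `o`
is the origin. -/
lemma exists_upper_halfplane {X : Set (ℝ × ℝ)} (hX : Convex ℝ X) (hc : IsClosed X) {o : ℝ × ℝ}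
    (ho : o ∉ X) (hne : X.Nonempty) : ∃ F : (ℝ × ℝ) ≃ᵃ[ℝ] (ℝ × ℝ), F o = 0 ∧
      (∀ x ∈ X, 0 < (F x).2) ∧
      ∀ (x y z : ℝ × ℝ) (α β : ℝ), F x = α • F y + β • F z → x - o = α • (y - o) + β • (z - o) := by
  obtain ⟨f, u, h1, h2⟩ := geometric_hahn_banach_point_closed hX hc ho
  have hf : ∀ x : ℝ × ℝ, f x = f (1, 0) * x.1 + f (0, 1) * x.2 := by
    intro x
    have : x = x.1 • (1, 0) + x.2 • (0, 1) := by ext <;> simp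
    conv_lhs => rw [this]
    rw [map_add, map_smul, map_smul]
    simp [mul_comm]
  generalize f (1, 0) = p at hf
  generalize f (0, 1) = q at hf
  have hpq : -q * q - p * p ≠ 0 := by
    obtain ⟨x, hx⟩ := hne
    intro h
    have hp : p = 0 := by nlinarith [mul_self_nonneg p, mul_self_nonneg q]
    have hq : q = 0 := by nlinarith [mul_self_nonneg p, mul_self_nonneg q]
    have := h2 x hx
    rw [hf, hp, hq] at this h1
    linarith
  obtain ⟨F, hF⟩ := exists_affineEquiv o hpq
  refine ⟨F, by rw [hF]; ext <;> simp, fun x hx => ?_, fun x y z α β h => ?_⟩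
  · have := h2 x hx
    rw [hf] at this h1
    rw [hF]
    simp only
    linarith
  · have : F x = F (o + (α • (y - o) + β • (z - o))) := by
      rw [h, hF, hF, hF]
      ext <;> simp <;> ring
    rw [F.injective this]
    abel

/-- The points of a large set that are seen from `o` and pairwise hidden by a closed convex set `X`
contain a sorted fan. -/
theorem sortedFan {ι : Type*} {X : Set (ℝ × ℝ)} (hX : Convex ℝ X) (hc : IsClosed X)
    {Y : Fin 2 → Set (ℝ × ℝ)} (hY : ∀ k, Convex ℝ (Y k)) (hXY : ∀ k, Disjoint X (Y k))
    {n : ℕ} {S : Finset ι} (hS : 3 * (n + 2) + 4 ≤ S.card) {o : ℝ × ℝ} {d : ι → ℝ × ℝ}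
    (hd : ∀ i ∈ S, ¬ Hit X o (d i)) (hYd : ∀ i ∈ S, ∀ k, ¬ Hit (Y k) o (d i))
    (hdd : ∀ i ∈ S, ∀ j ∈ S, i ≠ j → Hit X (d i) (d j)) : SortedFan o X Y S d n := by
  obtain ⟨i, hi, j, hj, hij⟩ := Finset.one_lt_card.1 (show 1 < S.card by omega)
  obtain ⟨x, -, hx⟩ := hdd i hi j hj hij
  obtain ⟨F, F0, Fpos, Fcomb⟩ := exists_upper_halfplane hX hc
    (fun h => hd i hi ⟨o, seg_left _ _, h⟩) ⟨x, hx⟩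
  have hz : ∀ {Z : Set (ℝ × ℝ)} {q : ℝ × ℝ}, Hit (F '' Z) 0 (F q) ↔ Hit Z o q := fun {Z q} => by
    rw [← F0]; exact hit_map F
  have hs : ∀ {q y : ℝ × ℝ}, F y ∈ segment ℝ 0 (F q) ↔ y ∈ segment ℝ o q := fun {q y} => by
    rw [← F0]; exact mem_seg_map F
  have hcr : ∀ {p q y : ℝ × ℝ}, Cross (F p) (F q) 0 (F y) ↔ Cross p q o y := fun {p q y} => by
    rw [← F0]; exact cross_map F
  obtain ⟨f, f1, f2, f3, f4, f5⟩ := sortedFan_zero (X := F '' X) (convex_map F hX)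
    (by rintro _ ⟨x, hx, rfl⟩; exact Fpos x hx) (Y := fun k => F '' Y k)
    (fun k => convex_map F (hY k)) (fun k => (Set.disjoint_image_iff F.injective).2 (hXY k))
    hS (d := fun i => F (d i)) (fun i hi => hz.not.2 (hd i hi))
    (fun i hi k => hz.not.2 (hYd i hi k))
    (fun i hi j hj hij => (hit_map F).2 (hdd i hi j hj hij))
  refine ⟨f, f1, f2, fun i => ?_, fun l m r hlm hmr => ?_, fun i e h1 h2 => ?_⟩
  · obtain ⟨_, ⟨a, ha, rfl⟩, h1, h2⟩ := f3 i
    exact ⟨a, ha, hs.1 h1, fun k => hz.not.1 (h2 k)⟩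
  · obtain ⟨α, β, hα, hβ, e⟩ := f4 l m r hlm hmr
    rw [sub_zero, sub_zero, sub_zero] at e
    exact ⟨α, β, hα, hβ, Fcomb _ _ _ _ _ e⟩
  · rcases f5 i (F e) ((hit_map F).not.2 h1) (h2.imp fun k => hz.2) with h | h
    · exact Or.inl fun m hm => hcr.1 (h m hm)
    · exact Or.inr fun m hm => hcr.1 (h m hm)

/-- Coordinates that take `c` to the origin and `r`, `m` to the standard basis. -/
lemma exists_frame {c r m : ℝ × ℝ} (h : det (r - c) (m - c) ≠ 0) :
    ∃ F : (ℝ × ℝ) ≃ᵃ[ℝ] (ℝ × ℝ), F c = (0, 0) ∧ F r = (1, 0) ∧ F m = (0, 1) := by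
  have hi := inv_mul_cancel₀ h
  have hi0 : (det (r - c) (m - c))⁻¹ ≠ 0 := inv_ne_zero h
  simp only [det, Prod.fst_sub, Prod.snd_sub] at hi hi0
  generalize ((r.1 - c.1) * (m.2 - c.2) - (r.2 - c.2) * (m.1 - c.1))⁻¹ = i at hi hi0
  obtain ⟨F, hF⟩ := exists_affineEquiv c (a := i * (m.2 - c.2)) (b := -i * (m.1 - c.1))
    (c := -i * (r.2 - c.2)) (d := i * (r.1 - c.1)) (fun h0 => hi0 (by linear_combination h0 - i * hi))
  refine ⟨F, ?_, ?_, ?_⟩ <;> rw [hF] <;> ext <;> simp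
  · linear_combination hi
  · ring
  · ring
  · linear_combination hi

/-! ### Stars separated by the third obstacle -/

lemma hit_base_zero {X : Set (ℝ × ℝ)} (hX : Convex ℝ X) {g l x u : ℝ × ℝ} {a b a' b' : ℝ}
    (hx : x ∈ X) (hu : u ∈ X) (ha : 0 ≤ a) (hb : 0 ≤ b) (hab : a + b ≤ 1)
    (ha' : 0 ≤ a') (hb' : 0 ≤ b') (hab' : 1 ≤ a' + b')
    (ex : x = a • g + b • l) (eu : u = a' • g + b' • l) : Hit X g l :=
  hit_base hX (c := 0) hx hu ha hb hab ha' hb' hab' (by simpa using ex) (by simpa using eu)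

lemma mem_of_hit {X : Set (ℝ × ℝ)} {p q : ℝ × ℝ} (h : Hit X p q) :
    ∃ t : ℝ, 0 ≤ t ∧ t ≤ 1 ∧ (1 - t) • p + t • q ∈ X := by
  obtain ⟨x, hx, hX⟩ := h
  obtain ⟨t, h0, h1, e1, e2⟩ := mem_seg.1 hx
  have : x = (1 - t) • p + t • q := by ext <;> simp [e1, e2]
  exact ⟨t, h0, h1, this ▸ hX⟩

lemma exists_scale {g z : ℝ × ℝ} (h : g ∈ segment ℝ 0 z) (hg : g ≠ 0) :
    ∃ k : ℝ, 1 ≤ k ∧ z = k • g := by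
  obtain ⟨t, h0, h1, rfl⟩ := mem_seg_zero h
  have ht : t ≠ 0 := by
    rintro rfl
    simp at hg
  have ht' : 0 < t := lt_of_le_of_ne h0 (Ne.symm ht)
  exact ⟨t⁻¹, one_le_inv_iff₀.2 ⟨ht', h1⟩, by rw [smul_smul, inv_mul_cancel₀ ht, one_smul]⟩

lemma not_smul_mem {X : Set (ℝ × ℝ)} {g : ℝ × ℝ} (h : ¬ Hit X 0 g) {k : ℝ} (h0 : 0 ≤ k)
    (hk : k • g ∈ X) : 1 < k := by
  by_contra h1
  exact h ⟨_, seg_ray_one h0 (not_lt.1 h1), hk⟩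

/-- If the segment from the origin to `g` crosses the segment between the two basis vectors, and
passes through neither, then `g` lies in the open first quadrant, beyond the crossing. -/
lemma pos_of_cross {g : ℝ × ℝ} (h : Cross 0 g (1, 0) (0, 1)) (h1 : (1, 0) ∉ segment ℝ 0 g)
    (h2 : (0, 1) ∉ segment ℝ 0 g) : 0 < g.1 ∧ 0 < g.2 ∧ 1 ≤ g.1 + g.2 := by
  obtain ⟨p, hp, hp'⟩ := h
  obtain ⟨t, h0, ht1, rfl⟩ := mem_seg_zero hp
  obtain ⟨s, hs0, hs1, e1, e2⟩ := mem_seg.1 hp'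
  simp at e1 e2
  have ht : 0 < t := by
    refine lt_of_le_of_ne h0 ?_
    rintro rfl
    linarith
  have hsum : t * (g.1 + g.2) = 1 := by linarith
  have hs : s ≠ 0 := by
    rintro rfl
    refine h1 ?_
    convert hp using 1
    ext <;> simp [e1, e2]
  have hs' : s ≠ 1 := by
    rintro rfl
    refine h2 ?_
    convert hp using 1
    ext <;> simp [e1, e2]
  refine ⟨?_, ?_, ?_⟩
  · by_contra hc
    have := lt_of_le_of_ne hs1 hs'
    nlinarith
  · by_contra hc
    have := lt_of_le_of_ne hs0 hs.symm
    nlinarith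
  · nlinarith

/-- An obstacle `A` that reaches behind the origin (as seen from `(1, 0)`) and hides `m` from the
origin, but hides `g` neither from the origin nor from `m`, misses the cone between `(1, 0)` and
`g`. -/
lemma not_mem_cone {A : Set (ℝ × ℝ)} (hA : Convex ℝ A) {g m a x : ℝ × ℝ} (hg : 0 < g.2)
    (ha : a ∈ A) (h0a : (0 : ℝ × ℝ) ∈ segment ℝ (1, 0) a) (hm : Hit A 0 m)
    (hg0 : ¬ Hit A 0 g) (hmg : ¬ Hit A m g) (hx : x ∈ A) (hx2 : 0 ≤ x.2) (hxg : 0 ≤ det x g) :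
    False := by
  obtain ⟨t, h0, h1, e1, e2⟩ := mem_seg.1 h0a
  simp at e1 e2
  have hA0 : (0 : ℝ × ℝ) ∉ A := fun h => hg0 ⟨0, seg_left _ _, h⟩
  have ht : t ≠ 0 := by
    rintro rfl
    linarith
  have ha2 : a.2 = 0 := e2.resolve_left ht
  have ht' : 0 < t := lt_of_le_of_ne h0 (Ne.symm ht)
  have ha1 : a.1 < 0 := by
    have h2 : a.1 ≤ 0 := by nlinarith
    refine lt_of_le_of_ne h2 fun h => hA0 ?_
    have : a = 0 := by ext <;> simp [h, ha2]
    exact this ▸ ha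
  have hda : det a g ≤ 0 := by
    unfold det
    rw [ha2]; nlinarith
  obtain ⟨s, hs0, hs1, hs⟩ := exists_convex_zero hda hxg
  have hw : (1 - s) • a + s • x ∈ A := hA ha hx (by linarith) hs0 (by ring)
  have ew := eq_smul_of_det_eq_zero hg (by rw [det_comb, hs])
  have hk : 0 ≤ ((1 - s) • a + s • x).2 / g.2 :=
    div_nonneg (by simpa [ha2] using mul_nonneg hs0 hx2) hg.le
  rw [ew] at hw
  generalize ((1 - s) • a + s • x).2 / g.2 = k at hk hw
  have hk1 := not_smul_mem hg0 hk hw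
  refine hmg (hit_comm (hit_of_shadow hA hw ?_ hm))
  have := seg_ray_zero (d := g) zero_le_one hk1.le
  rwa [one_smul] at this

/-- An obstacle that hides `g` from `(1, 0)` but not from the origin or `(0, 1)` misses the
triangle spanned by the origin, `g` and `(0, 1)`. -/
lemma not_mem_triangle {B : Set (ℝ × ℝ)} (hB : Convex ℝ B) {g x : ℝ × ℝ} (hg1 : 0 < g.1)
    (hg2 : 0 < g.2) (hr : Hit B (1, 0) g) (h0 : ¬ Hit B 0 g) (hm : ¬ Hit B (0, 1) g) (hx : x ∈ B)
    {a b : ℝ} (ha : 0 ≤ a) (hb : 0 ≤ b) (hab : a + b ≤ 1) (e : x = a • g + b • (0, 1)) : False := by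
  obtain ⟨k, hk0, hk1, hk⟩ := mem_of_hit hr
  have d1 : det x g ≤ 0 := by
    rw [e, det_comb, det_self]
    simp [det]
    nlinarith
  have d2 : 0 ≤ det ((1 - k) • ((1 : ℝ), (0 : ℝ)) + k • g) g := by
    rw [det_comb, det_self]
    simp [det]
    nlinarith
  obtain ⟨s, hs0, hs1, hs⟩ := exists_convex_zero d1 d2
  have hw := hB hx hk (show 0 ≤ 1 - s by linarith) hs0 (by ring)
  have ew := eq_smul_of_det_eq_zero hg2 (by rw [det_comb, hs])
  rw [ew] at hw
  have hd := div_nonneg (show 0 ≤ ((1 - s) • x + s • ((1 - k) • ((1 : ℝ), (0 : ℝ)) + k • g)).2 by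
    simp [e]
    have := mul_nonneg (sub_nonneg.2 hs1) (add_nonneg (mul_nonneg ha hg2.le) hb)
    have := mul_nonneg hs0 (mul_nonneg hk0 hg2.le)
    linarith) hg2.le
  generalize ((1 - s) • x + s • ((1 - k) • ((1 : ℝ), (0 : ℝ)) + k • g)).2 / g.2 = d at hd hw
  have hd1 := not_smul_mem h0 hd hw
  exact hm (hit_comm (hit_base_zero hB hx hw ha hb hab hd le_rfl (by linarith) e (by simp)))

/-- The position of a star with centre `0`, normalized so that the root is `(1, 0)` and another
child of the root is `(0, 1)`. The points `g` and `h` are neighbours of the centre, and `l` is a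
neighbour of `h` whose segment crosses the one from the centre to `g`. The obstacle `A` separates
the children of the root, `B` hides `g` and `h` from the root, and `C` separates the neighbours of
the centre. -/
structure ThirdStar (A B C : Set (ℝ × ℝ)) (g h l : ℝ × ℝ) : Prop where
  convA : Convex ℝ A
  convB : Convex ℝ B
  convC : Convex ℝ C
  disj : Disjoint B C
  cross_h : Cross 0 h (1, 0) (0, 1)
  cross_l : Cross h l 0 g
  no_cross : ¬ Cross h l (1, 0) (0, 1)
  g_pos : 0 < g.1 ∧ 0 < g.2 ∧ 1 ≤ g.1 + g.2
  h_pos : 0 < h.1 ∧ 0 < h.2 ∧ 1 ≤ h.1 + h.2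
  A_m : Hit A 0 (0, 1)
  A_behind : ∃ a ∈ A, (0 : ℝ × ℝ) ∈ segment ℝ (1, 0) a
  A_root : ¬ Hit A (1, 0) (0, 1)
  A_g : ¬ Hit A 0 g
  A_mg : ¬ Hit A (0, 1) g
  A_hl : ¬ Hit A h l
  B_g : ¬ Hit B 0 g
  B_h : ¬ Hit B 0 h
  B_mg : ¬ Hit B (0, 1) g
  B_mh : ¬ Hit B (0, 1) h
  B_hl : ¬ Hit B h l
  B_rg : Hit B (1, 0) g
  B_rh : Hit B (1, 0) h
  C_hl : ¬ Hit C h l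
  C_mh : Hit C (0, 1) h
  C_g : ∃ z ∈ C, g ∈ segment ℝ 0 z ∧ ¬ Hit B 0 z
  C_h : ∃ z ∈ C, h ∈ segment ℝ 0 z
  split : (Hit A 0 l ∧ Hit B g l) ∨ (Hit B 0 l ∧ Hit A g l)

/-- A convex set with a point on the negative first axis and a point of `[g, l]` below that axis
hides `l` from the point `v` where the segment from `τ • g` to `l` crosses the axis. -/
lemma hit_of_straddle {A : Set (ℝ × ℝ)} (hA : Convex ℝ A) {g l v a : ℝ × ℝ} {τ t s : ℝ}
    (hg2 : 0 < g.2) (hl2 : l.2 < 0) (hlg : 0 ≤ det l g) (hτ1 : τ ≤ 1)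
    (ht0 : 0 ≤ t) (hv : v = t • (τ • g) + (1 - t) • l) (hv2 : v.2 = 0)
    (hv1 : 0 < v.1) (ha : a ∈ A) (ha1 : a.1 ≤ 0) (ha2 : a.2 = 0) (hs1 : s ≤ 1)
    (hs : (1 - s) • g + s • l ∈ A) (hw2 : ((1 - s) • g + s • l).2 < 0) : Hit A v l := by
  have hs1' := sub_nonneg.2 hs1
  obtain ⟨s', hs'0, hs'1, hs'⟩ := exists_convex_zero hl2.le hg2.le
  have hvg : v.1 * g.2 = (1 - t) * det l g := by
    have : det v g = (1 - t) * det l g := by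
      rw [hv, det_comb, det_smul_left, det_self]; ring
    rw [← this, det, hv2]; ring
  have ht : (1 - t) * l.2 + t * (τ * g.2) = 0 := by
    rw [hv] at hv2
    simp at hv2
    linarith
  obtain ⟨v', hv'⟩ : ∃ v', v' = s' • g + (1 - s') • l := ⟨_, rfl⟩
  have hv'2 : v'.2 = 0 := by simp [hv']; linarith
  have hle : v.1 ≤ v'.1 := by
    have h3 : v'.1 * g.2 = (1 - s') * det l g := by
      have : det v' g = (1 - s') * det l g := by
        rw [hv', det_comb, det_self]; ring
      rw [← this, det, hv'2]; ring
    have h4 : 1 - t ≤ 1 - s' := by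
      -- `(1 - t) / t ≤ (1 - s') / s'`, as `τ • g` is nearer to the axis than `g`
      by_contra hc
      have hts : t < s' := by linarith
      nlinarith [mul_nonneg ht0 (mul_nonneg (sub_nonneg.2 hτ1) hg2.le),
        mul_pos (sub_pos.2 hts) hg2, mul_pos (sub_pos.2 hts) (neg_pos.2 hl2)]
    have h5 := mul_le_mul_of_nonneg_right h4 hlg
    by_contra hc
    nlinarith
  have h1s : 1 - s' ≤ s := by
    by_contra hc
    simp at hw2
    nlinarith [mul_pos (sub_pos.2 (not_le.1 hc)) hg2,
      mul_pos (sub_pos.2 (not_le.1 hc)) (neg_pos.2 hl2)]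
  have hw : (1 - s) • g + s • l ∈ segment ℝ v' l := by
    rcases eq_or_lt_of_le hs'0 with h0 | h0
    · have : s = 1 := by linarith
      rw [this]; simpa using seg_right v' l
    · refine mem_seg.2 ⟨1 - (1 - s) / s', ?_, ?_, ?_, ?_⟩
      · rw [sub_nonneg, div_le_one h0]; linarith
      · have := div_nonneg hs1' hs'0; linarith
      · simp [hv']; field_simp; ring
      · simp [hv']; field_simp; ring
  have hva : v ∈ segment ℝ v' a := by
    have hva' : 0 < v'.1 - a.1 := by linarith
    refine mem_seg.2 ⟨(v'.1 - v.1) / (v'.1 - a.1), div_nonneg (by linarith) hva'.le, ?_, ?_, ?_⟩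
    · rw [div_le_one hva']; linarith
    · field_simp; ring
    · simp [hv2, hv'2, ha2]
  obtain ⟨y, hy, hy'⟩ := cevians_cross hw hva
  exact ⟨y, hy', hA.segment_subset hs ha hy⟩

/-- The case that the edge from `h` to its leaf crosses the ray through `g` in the clockwise direction. -/
lemma ThirdStar.false_of_det_neg {A B C : Set (ℝ × ℝ)} {g h l : ℝ × ℝ}
    (S : ThirdStar A B C g h l) (hD : det h g < 0) : False := by
  obtain ⟨hg1, hg2, hg⟩ := S.g_pos
  obtain ⟨hh1, hh2, hh⟩ := S.h_pos
  obtain ⟨a, ha, ha0⟩ := S.A_behind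
  have cone : ∀ x ∈ A, 0 ≤ x.2 → 0 ≤ det x g → False := fun x hx h1 h2 =>
    not_mem_cone S.convA hg2 ha ha0 S.A_m S.A_g S.A_mg hx h1 h2
  obtain ⟨q, hq, hq'⟩ := S.cross_l
  obtain ⟨τ, hτ0, hτ1, eq⟩ := mem_seg_zero hq'
  obtain ⟨ρ, hρ0, hρ1, q1, q2⟩ := mem_seg.1 hq
  have hqρ : q = (1 - ρ) • h + ρ • l := by ext <;> simp [q1, q2]
  have hρD : ρ * det l g = -(1 - ρ) * det h g := by
    have : det q g = 0 := by rw [eq, det_smul_left, det_self, mul_zero]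
    rw [hqρ, det_comb] at this
    linarith
  have hρ : 0 < ρ := by
    refine lt_of_le_of_ne hρ0 ?_
    rintro rfl
    have : det h g = 0 := by linarith
    linarith
  have hlg : 0 ≤ det l g := by
    by_contra hc
    nlinarith [mul_nonneg (sub_nonneg.2 hρ1) (neg_pos.2 hD).le]
  rcases le_or_gt 0 l.2 with hl2 | hl2
  · -- `l` lies in the cone between the root and `g`, where `A` hides nothing
    rcases S.split with ⟨h1, -⟩ | ⟨-, h1⟩
    · obtain ⟨t, ht0, ht1, ht⟩ := mem_of_hit h1
      refine cone _ ht ?_ ?_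
      · simpa using mul_nonneg ht0 hl2
      · rw [det_comb]
        simpa [det] using mul_nonneg ht0 hlg
    · obtain ⟨t, ht0, ht1, ht⟩ := mem_of_hit h1
      have ht1' := sub_nonneg.2 ht1
      refine cone _ ht ?_ ?_
      · simpa using add_nonneg (mul_nonneg ht1' hg2.le) (mul_nonneg ht0 hl2)
      · rw [det_comb, det_self]
        simpa using mul_nonneg ht0 hlg
  · -- otherwise `[q, l]` crosses the ray to the root at `v`
    have hq2 : 0 ≤ q.2 := by rw [eq]; simpa using mul_nonneg hτ0 hg2.le
    obtain ⟨t, ht0, ht1, ht⟩ := exists_convex_zero hl2.le hq2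
    have hvseg : (t • q + (1 - t) • l) ∈ segment ℝ q l :=
      seg_comb ht0 (by linarith) (by ring)
    set v := t • q + (1 - t) • l with hv
    have hvl : v ∈ segment ℝ h l := seg_sub hq (seg_right _ _) hvseg
    have hv2 : v.2 = 0 := by simp [hv]; linarith
    have hvg : v.1 * g.2 = (1 - t) * det l g := by
      have : det v g = (1 - t) * det l g := by
        rw [hv, det_comb, eq, det_smul_left, det_self]; ring
      rw [← this, det, hv2]; ring
    have hv1 : 0 ≤ v.1 := by
      have := mul_nonneg (sub_nonneg.2 ht1) hlg
      by_contra hc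
      nlinarith
    rcases le_or_gt v.1 1 with hv1' | hv1'
    · obtain ⟨p, hp, hp'⟩ := S.cross_h
      have : v ∈ segment ℝ (0 : ℝ × ℝ) (1, 0) :=
        mem_seg.2 ⟨v.1, hv1, hv1', by simp, by simp [hv2]⟩
      obtain ⟨y, hy, hy'⟩ := cevians_cross this hp
      exact S.no_cross ⟨y, seg_sub hvl (seg_left _ _) hy, seg_sub hp' (seg_left _ _) hy'⟩
    · rcases S.split with ⟨-, h1⟩ | ⟨-, h1⟩
      · -- `B` has points on both sides of `[h, l]` within the cone
        obtain ⟨s, hs0, hs1, hs⟩ := mem_of_hit h1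
        obtain ⟨k, hk0, hk1, hk⟩ := mem_of_hit S.B_rh
        have hτ : 0 < τ := by
          refine lt_of_le_of_ne hτ0 ?_
          rintro rfl
          rw [zero_smul] at eq
          have e2 : (1 - t) * l.2 = 0 := by
            have := ht; rw [eq] at this; simpa using this
          have e3 : (1 - t) = 0 := (mul_eq_zero.1 e2).resolve_right hl2.ne
          have : v.1 = 0 := by simp [hv, eq, e3]
          linarith
        have hv0 : 0 < v.1 := by linarith
        have hk1' := sub_nonneg.2 hk1
        have hs1' := sub_nonneg.2 hs1
        have hρ1' := sub_nonneg.2 hρ1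
        have ht1' := sub_nonneg.2 ht1
        have er : ((1 : ℝ), (0 : ℝ)) = v.1⁻¹ • v := by
          ext
          · simp; field_simp
          · simp [hv2]
        have eg : g = τ⁻¹ • q := by rw [eq, smul_smul, inv_mul_cancel₀ hτ.ne', one_smul]
        have hi : v.1⁻¹ ≤ 1 := inv_le_one_of_one_le₀ hv1'.le
        have hi0 : 0 ≤ v.1⁻¹ := (inv_pos.2 hv0).le
        have hj : 1 ≤ τ⁻¹ := one_le_inv_iff₀.2 ⟨hτ, hτ1⟩
        rw [er] at hk
        rw [eg] at hs
        generalize v.1⁻¹ = i at hk hi hi0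
        generalize τ⁻¹ = j at hs hj
        have hj0 : 0 ≤ j := by linarith
        refine S.B_hl (hit_base_zero S.convB hk hs
          (a := (1 - k) * i * (t * (1 - ρ)) + k) (b := (1 - k) * i * (t * ρ + (1 - t)))
          (a' := (1 - s) * j * (1 - ρ)) (b' := (1 - s) * j * ρ + s)
          (by positivity) (by positivity) ?_ (by positivity) (by positivity) ?_ ?_ ?_)
        · nlinarith [mul_nonneg hk1' (sub_nonneg.2 hi)]
        · nlinarith [mul_nonneg hs1' (sub_nonneg.2 hj)]
        · rw [hv, hqρ]; ext <;> simp <;> ring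
        · rw [hqρ]; ext <;> simp <;> ring
      · obtain ⟨s, hs0, hs1, hs⟩ := mem_of_hit h1
        have hs1' := sub_nonneg.2 hs1
        rcases le_or_gt 0 ((1 - s) • g + s • l).2 with hw2 | hw2
        · refine cone _ hs hw2 ?_
          rw [det_comb, det_self]
          simpa using mul_nonneg hs0 hlg
        · -- `A` has points behind the centre and on the other side of `[h, l]`
          obtain ⟨r, hr0, hr1, e1, e2⟩ := mem_seg.1 ha0
          simp at e1 e2
          have hr : r ≠ 0 := by
            rintro rfl
            linarith
          have ha1 : a.1 ≤ 0 := by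
            have : 0 < r := lt_of_le_of_ne hr0 (Ne.symm hr)
            nlinarith
          exact S.A_hl ((hit_of_straddle S.convA hg2 hl2 hlg hτ1 ht0 (eq ▸ hv) hv2
            (by linarith) ha ha1 (e2.resolve_left hr) hs1 hs hw2).mono hvl (seg_right _ _))

/-- The leaf `l` is not on the side of `g` of the ray through `(0, 1)` when it is `B` that hides it
from `g`. If `(0, 1)` is on the near side of the line through `h` and `l`, then `B` has to cross the
segment between a point of `C` behind `g` and a point of `C` behind `l`. If not, then `l` lies in the
triangle spanned by the centre, `h` and `(0, 1)`, which `B` does not enter. -/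
lemma ThirdStar.false_of_far {A B C : Set (ℝ × ℝ)} {g h l q : ℝ × ℝ} {τ ρ : ℝ}
    (S : ThirdStar A B C g h l) (hD : 0 < det h g) (hτ0 : 0 ≤ τ) (hρ0 : 0 < ρ) (hρ1 : ρ ≤ 1)
    (eq : q = τ • g) (hqρ : q = (1 - ρ) • h + ρ • l) (hlg : det l g ≤ 0) (hl1 : 0 < l.1)
    (hB : Hit B g l) : False := by
  obtain ⟨hg1, hg2, hg⟩ := S.g_pos
  obtain ⟨hh1, hh2, hh⟩ := S.h_pos
  obtain ⟨s, hs0, hs1, hu⟩ := mem_of_hit hB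
  obtain ⟨k, hk0, hk1, hx⟩ := mem_of_hit S.C_mh
  obtain ⟨r, hr0, hr1, hβ⟩ := mem_of_hit S.B_rg
  obtain ⟨z, hz, hgz, hBz⟩ := S.C_g
  obtain ⟨z', hz', hhz'⟩ := S.C_h
  obtain ⟨ζ, hζ, rfl⟩ := exists_scale hgz (by rintro rfl; simp at hg1)
  obtain ⟨ζ', hζ', rfl⟩ := exists_scale hhz' (by rintro rfl; simp at hh1)
  have hs1' := sub_nonneg.2 hs1
  have hk1' := sub_nonneg.2 hk1
  have hρ1' := sub_nonneg.2 hρ1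
  have triG : ∀ x ∈ B, ∀ a b : ℝ, 0 ≤ a → 0 ≤ b → a + b ≤ 1 → x ≠ a • g + b • (0, 1) :=
    fun x hx a b ha hb hab e =>
      not_mem_triangle S.convB hg1 hg2 S.B_rg S.B_g S.B_mg hx ha hb hab e
  have triH : ∀ x ∈ B, ∀ a b : ℝ, 0 ≤ a → 0 ≤ b → a + b ≤ 1 → x ≠ a • h + b • (0, 1) :=
    fun x hx a b ha hb hab e =>
      not_mem_triangle S.convB hh1 hh2 S.B_rh S.B_h S.B_mh hx ha hb hab e
  have hτ : 0 < τ := by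
    refine lt_of_le_of_ne hτ0 ?_
    rintro rfl
    have : q.1 = 0 := by rw [eq]; simp
    rw [hqρ] at this
    simp at this
    nlinarith [mul_nonneg hρ1' hh1.le, mul_pos hρ0 hl1]
  have hhl : 0 < det h l := by
    have : ρ * det h l = τ * det h g := by
      rw [← det_smul_right τ, ← eq, hqρ]
      simp [det]; ring
    by_contra hc
    nlinarith [mul_pos hτ hD]
  -- coordinates of `m = (0, 1)` with respect to `h` and `l`
  have em := cramer ((0 : ℝ), (1 : ℝ)) hhl.ne'
  have hma : det ((0 : ℝ), (1 : ℝ)) l / det h l < 0 :=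
    div_neg_of_neg_of_pos (by simp [det]; exact hl1) hhl
  have hmb : 0 < det h ((0 : ℝ), (1 : ℝ)) / det h l :=
    div_pos (by simp [det]; exact hh1) hhl
  generalize det ((0 : ℝ), (1 : ℝ)) l / det h l = ma at em hma
  generalize det h ((0 : ℝ), (1 : ℝ)) / det h l = mb at em hmb
  rcases le_or_gt (ma + mb) 1 with hm | hm
  · have ex : (1 - k) • ((0 : ℝ), (1 : ℝ)) + k • h =
        ((1 - k) * ma + k) • h + ((1 - k) * mb) • l := by
      rw [em]; ext <;> simp <;> ring
    rw [ex] at hx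
    have hxa : (1 - k) * ma + k < 0 := by
      by_contra hc
      exact S.C_hl (hit_base_zero S.convC hx hz' (a' := ζ') (b' := 0) (not_lt.1 hc)
        (mul_nonneg hk1' hmb.le) (by nlinarith) (by linarith) le_rfl (by linarith) rfl (by rw [zero_smul, add_zero]))
    have ez : ζ • g = (ζ / τ * (1 - ρ)) • h + (ζ / τ * ρ) • l := by
      have : g = τ⁻¹ • q := by rw [eq, smul_smul, inv_mul_cancel₀ hτ.ne', one_smul]
      rw [this, hqρ]; ext <;> simp <;> ring
    have hζτ : 0 < ζ / τ := div_pos (by linarith) hτ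
    have hz1 := hz
    rw [ez] at hz1
    -- the point where `C` crosses the ray through `l`
    obtain ⟨t, ht0, ht1, ht⟩ := exists_convex_zero hxa.le (mul_nonneg hζτ.le hρ1')
    have hw := S.convC hx hz1 (sub_nonneg.2 ht1) ht0 (by ring)
    have ew : (1 - t) • (((1 - k) * ma + k) • h + ((1 - k) * mb) • l) +
        t • ((ζ / τ * (1 - ρ)) • h + (ζ / τ * ρ) • l) =
        ((1 - t) * ((1 - k) * mb) + t * (ζ / τ * ρ)) • l := by
      ext
      · simp; linear_combination h.1 * ht
      · simp; linear_combination h.2 * ht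
    rw [ew] at hw
    have hv0 : 0 ≤ (1 - t) * ((1 - k) * mb) + t * (ζ / τ * ρ) :=
      add_nonneg (mul_nonneg (sub_nonneg.2 ht1) (mul_nonneg hk1' hmb.le))
        (mul_nonneg ht0 (mul_nonneg hζτ.le hρ0.le))
    generalize (1 - t) * ((1 - k) * mb) + t * (ζ / τ * ρ) = v at hw hv0
    have hv1 : 1 < v := by
      by_contra hc
      exact S.C_hl (hit_base_zero S.convC hw hz' (a' := ζ') (b' := 0) le_rfl hv0 (by linarith)
        (by linarith) le_rfl (by linarith) (by rw [zero_smul, zero_add]) (by rw [zero_smul, add_zero]))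
    -- the point where `B` crosses the ray through `g`
    have d1 : det ((1 - s) • g + s • l) g ≤ 0 := by
      rw [det_comb, det_self]
      simpa using mul_nonpos_of_nonneg_of_nonpos hs0 hlg
    have d2 : 0 ≤ det ((1 - r) • ((1 : ℝ), (0 : ℝ)) + r • g) g := by
      rw [det_comb, det_self]
      simpa [det] using mul_nonneg (sub_nonneg.2 hr1) hg2.le
    obtain ⟨p, hp0, hp1, hp⟩ := exists_convex_zero d1 d2
    have hσ := S.convB hu hβ (sub_nonneg.2 hp1) hp0 (by ring)
    have eσ := eq_smul_of_det_eq_zero hg2 (by rw [det_comb, hp])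
    rw [eσ] at hσ
    have hl2 : 0 ≤ l.2 := by
      have : l.1 * g.2 - l.2 * g.1 ≤ 0 := hlg
      by_contra hc
      nlinarith [mul_pos hl1 hg2, mul_pos (neg_pos.2 (not_le.1 hc)) hg1]
    have hσ0 := div_nonneg (show 0 ≤ ((1 - p) • ((1 - s) • g + s • l) +
        p • ((1 - r) • ((1 : ℝ), (0 : ℝ)) + r • g)).2 by
      simp
      have := mul_nonneg (sub_nonneg.2 hp1) (add_nonneg (mul_nonneg hs1' hg2.le)
        (mul_nonneg hs0 hl2))
      have := mul_nonneg hp0 (mul_nonneg hr0 hg2.le)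
      linarith) hg2.le
    generalize ((1 - p) • ((1 - s) • g + s • l) +
        p • ((1 - r) • ((1 : ℝ), (0 : ℝ)) + r • g)).2 / g.2 = σ at hσ hσ0
    have hσζ : ζ < σ := by
      by_contra hc
      exact hBz ⟨_, seg_ray_zero hσ0 (not_lt.1 hc), hσ⟩
    have hζ0 : 0 < ζ := by linarith
    have hv0' : 0 < v := by linarith
    obtain ⟨y, hy, hyB⟩ := hit_base_zero S.convB (g := ζ • g) (l := v • l) hu hσ
      (a := (1 - s) / ζ) (b := s / v) (a' := σ / ζ) (b' := 0) (by positivity) (by positivity)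
      (by
        have h1 : (1 - s) / ζ ≤ 1 - s := div_le_self hs1' hζ
        have h2 : s / v ≤ s := div_le_self hs0 hv1.le
        linarith)
      (by positivity) le_rfl (by rw [add_zero, one_le_div hζ0]; exact hσζ.le)
      (by rw [smul_smul, smul_smul, div_mul_cancel₀ _ hζ0.ne', div_mul_cancel₀ _ hv0'.ne'])
      (by rw [smul_smul, div_mul_cancel₀ _ hζ0.ne', zero_smul, add_zero])
    exact Set.disjoint_left.1 S.disj hyB (S.convC.segment_subset hz hw hy)
  · -- `l` lies in the triangle `0`, `h`, `m`
    have el : l = (-ma / mb) • h + (1 / mb) • ((0 : ℝ), (1 : ℝ)) := by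
      rw [em]; ext <;> simp <;> field_simp <;> ring
    have hx0 : 0 ≤ -ma / mb := div_nonneg (by linarith) hmb.le
    have hy0 : 0 ≤ 1 / mb := div_nonneg zero_le_one hmb.le
    have hxy : -ma / mb + 1 / mb ≤ 1 := by
      rw [← add_div, div_le_one hmb]; linarith
    generalize -ma / mb = x at el hx0 hxy
    generalize 1 / mb = y at el hy0 hxy
    have eg : g = (g.1 / h.1) • h + (det h g / h.1) • ((0 : ℝ), (1 : ℝ)) := by
      ext
      · simp; field_simp
      · simp [det]; field_simp; ring
    have hα : 0 < g.1 / h.1 := div_pos hg1 hh1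
    have hβ' : 0 < det h g / h.1 := div_pos hD hh1
    generalize g.1 / h.1 = α at eg hα
    generalize det h g / h.1 = β at eg hβ'
    rcases le_or_gt (α + β) 1 with hαβ | hαβ
    · refine triH _ hu ((1 - s) * α + s * x) ((1 - s) * β + s * y) (by positivity)
        (by positivity) ?_ ?_
      · nlinarith [mul_nonneg hs1' (sub_nonneg.2 hαβ), mul_nonneg hs0 (sub_nonneg.2 hxy)]
      rw [el, eg]; ext <;> simp <;> ring
    · have el' : l = (x / α) • g + (y - x / α * β) • ((0 : ℝ), (1 : ℝ)) := by
        rw [el, eg]; ext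
        · simp; field_simp
        · simp; field_simp
      have hxα : 0 ≤ x / α := div_nonneg hx0 hα.le
      have hyn : 0 ≤ y - x / α * β := by
        have h1 : det l g = -(y - x / α * β) * g.1 := by
          conv_lhs => rw [el', det_comb, det_self]
          simp [det]; ring
        by_contra hc
        nlinarith
      have hsum : x / α + (y - x / α * β) ≤ 1 := by
        have hxx : x / α * α = x := div_mul_cancel₀ _ hα.ne'
        nlinarith [mul_nonneg hxα (sub_nonneg.2 hαβ.le)]
      refine triG _ hu ((1 - s) + s * (x / α)) (s * (y - x / α * β)) (by positivity)
        (by positivity) (by nlinarith [mul_nonneg hs0 (sub_nonneg.2 hsum)]) ?_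
      conv_lhs => rw [el']
      ext <;> simp <;> ring

/-- The case that the edge from `h` to its leaf crosses the ray through `g` in the anticlockwise
direction. -/
lemma ThirdStar.false_of_det_pos {A B C : Set (ℝ × ℝ)} {g h l : ℝ × ℝ}
    (S : ThirdStar A B C g h l) (hD : 0 < det h g) : False := by
  obtain ⟨hg1, hg2, hg⟩ := S.g_pos
  obtain ⟨hh1, hh2, hh⟩ := S.h_pos
  obtain ⟨q, hq, hq'⟩ := S.cross_l
  obtain ⟨τ, hτ0, hτ1, eq⟩ := mem_seg_zero hq'
  obtain ⟨ρ, hρ0, hρ1, q1, q2⟩ := mem_seg.1 hq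
  have hqρ : q = (1 - ρ) • h + ρ • l := by ext <;> simp [q1, q2]
  have hρ1' := sub_nonneg.2 hρ1
  have hρD : ρ * det l g = -(1 - ρ) * det h g := by
    have : det q g = 0 := by rw [eq, det_smul_left, det_self, mul_zero]
    rw [hqρ, det_comb] at this
    linarith
  have hρ : 0 < ρ := by
    refine lt_of_le_of_ne hρ0 ?_
    rintro rfl
    have : det h g = 0 := by linarith
    linarith
  have hlg : det l g ≤ 0 := by
    by_contra hc
    nlinarith [mul_nonneg hρ1' hD.le]
  rcases le_or_gt l.1 0 with hl1 | hl1
  · -- `[q, l]` crosses the ray through `(0, 1)` at `v`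
    have hq1 : 0 ≤ q.1 := by rw [eq]; simpa using mul_nonneg hτ0 hg1.le
    obtain ⟨t, ht0, ht1, ht⟩ := exists_convex_zero hl1 hq1
    have ht1' := sub_nonneg.2 ht1
    obtain ⟨v, hv⟩ : ∃ v, v = t • q + (1 - t) • l := ⟨_, rfl⟩
    have hvl : v ∈ segment ℝ h l :=
      seg_sub hq (seg_right _ _) (hv ▸ seg_comb ht0 ht1' (by ring))
    have hv1 : v.1 = 0 := by simp [hv]; linarith
    have hv2 : 0 ≤ v.2 := by
      have h1 : det v g = (1 - t) * det l g := by
        rw [hv, det_comb, eq, det_smul_left, det_self]; ring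
      have h2 : det v g = -v.2 * g.1 := by rw [det, hv1]; ring
      have := mul_nonneg ht1' (neg_nonneg.2 hlg)
      by_contra hc
      nlinarith
    rcases le_or_gt v.2 1 with hv2' | hv2'
    · obtain ⟨p, hp, hp'⟩ := S.cross_h
      have : v ∈ segment ℝ (0 : ℝ × ℝ) (0, 1) :=
        mem_seg.2 ⟨v.2, hv2, hv2', by simp [hv1], by simp⟩
      obtain ⟨y, hy, hy'⟩ := cevians_cross this hp
      exact S.no_cross ⟨y, seg_sub hvl (seg_left _ _) hy, seg_sub hp' (seg_right _ _) hy'⟩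
    · -- `C` has points on both sides of `[h, l]` within the cone
      obtain ⟨k, hk0, hk1, hx⟩ := mem_of_hit S.C_mh
      obtain ⟨z', hz', hhz'⟩ := S.C_h
      obtain ⟨ζ', hζ', rfl⟩ := exists_scale hhz' (by rintro rfl; simp at hh1)
      have hk1' := sub_nonneg.2 hk1
      have em : ((0 : ℝ), (1 : ℝ)) = v.2⁻¹ • v := by
        ext
        · simp [hv1]
        · simp; field_simp
      have hi : v.2⁻¹ ≤ 1 := inv_le_one_of_one_le₀ hv2'.le
      have hi0 : 0 ≤ v.2⁻¹ := inv_nonneg.2 hv2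
      rw [em] at hx
      generalize v.2⁻¹ = i at hx hi hi0
      refine S.C_hl (hit_base_zero S.convC hx hz'
        (a := (1 - k) * i * (t * (1 - ρ)) + k) (b := (1 - k) * i * (t * ρ + (1 - t)))
        (a' := ζ') (b' := 0) (by positivity) (by positivity) ?_ (by linarith) le_rfl (by linarith) ?_
        (by rw [zero_smul, add_zero]))
      · nlinarith [mul_nonneg hk1' (sub_nonneg.2 hi)]
      · rw [hv, hqρ]; ext <;> simp <;> ring
  · have hl2 : 0 ≤ l.2 := by
      have : l.1 * g.2 - l.2 * g.1 ≤ 0 := hlg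
      by_contra hc
      nlinarith [mul_pos hl1 hg2, mul_pos (neg_pos.2 (not_le.1 hc)) hg1]
    have coord : ∀ x : ℝ × ℝ, x = x.1 • ((1 : ℝ), (0 : ℝ)) + x.2 • ((0 : ℝ), (1 : ℝ)) := by
      intro x; ext <;> simp
    rcases le_or_gt (l.1 + l.2) 1 with hl | hl
    · obtain ⟨y, hy, hy'⟩ := hit_base_zero (convex_segment h l) (seg_right h l) (seg_left h l)
        hl1.le hl2 hl hh1.le hh2.le hh (coord l) (coord h)
      exact S.no_cross ⟨y, hy', hy⟩
    · rcases S.split with ⟨-, h1⟩ | ⟨-, h1⟩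
      · exact S.false_of_far hD hτ0 hρ hρ1 eq hqρ hlg hl1 h1
      · -- `A` has points on both sides of the segment from `(1, 0)` to `(0, 1)`
        obtain ⟨s, hs0, hs1, hs⟩ := mem_of_hit h1
        obtain ⟨k, hk0, hk1, hk⟩ := mem_of_hit S.A_m
        have hs1' := sub_nonneg.2 hs1
        refine S.A_root (hit_base_zero S.convA hk hs (a := 0) (b := k) le_rfl hk0 (by linarith)
          (a' := (1 - s) * g.1 + s * l.1) (b' := (1 - s) * g.2 + s * l.2) (by positivity)
          (by positivity) (by nlinarith) (by simp) ?_)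
        ext <;> simp

lemma ThirdStar.elim {A B C : Set (ℝ × ℝ)} {g h l : ℝ × ℝ} (S : ThirdStar A B C g h l)
    (hD : det h g ≠ 0) : False := by
  rcases lt_or_gt_of_ne hD with h | h
  · exact S.false_of_det_neg h
  · exact S.false_of_det_pos h

/-! ### Stars separated by the obstacle that hides them from the root -/

/-- The position of two stars with centres `0` and `n`, normalized so that the root is `(1, 0)` and
a third child of the root is `(0, 1)`. The point `g` is a neighbour of the centre `0`, and `h` is a
neighbour of `n` whose segment crosses those from the root to `0` and to `(0, 1)`, in this order.
The obstacle `A` separates the children of the root, and `B` hides `g` and `h` from the root and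
separates the neighbours of either centre. -/
structure BlockerStar (A B C : Set (ℝ × ℝ)) (n g h p : ℝ × ℝ) : Prop where
  convA : Convex ℝ A
  convB : Convex ℝ B
  convC : Convex ℝ C
  disj : Disjoint B C
  p_mem : p ∈ segment ℝ n h
  p_one : 0 ≤ p.1
  p_two : p.2 = 0
  cross_h : Cross p h (1, 0) (0, 1)
  g_pos : 0 < g.1 ∧ 0 < g.2 ∧ 1 ≤ g.1 + g.2
  A_n : Hit A n 0
  A_nh : ¬ Hit A n h
  B_nh : ¬ Hit B n h
  B_g : ¬ Hit B 0 g
  B_h : ¬ Hit B 0 h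
  B_rh : Hit B (1, 0) h
  behind_g : ∃ b ∈ B, g ∈ segment ℝ 0 b ∧ ¬ Hit C 0 b
  behind_h : ∃ b ∈ B, h ∈ segment ℝ n b
  C_nh : ¬ Hit C n h
  C_g : ¬ Hit C 0 g
  C_h : Hit C 0 h
  C_mg : Hit C (0, 1) g
  split : Hit A n g ∨ Hit B n g ∨ Hit C n g

lemma BlockerStar.p_pos {A B C : Set (ℝ × ℝ)} {n g h p : ℝ × ℝ} (S : BlockerStar A B C n g h p) :
    0 < p.1 := by
  refine lt_of_le_of_ne S.p_one fun h0 => S.A_nh ?_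
  have : p = 0 := by ext <;> simp [← h0, S.p_two]
  exact S.A_n.mono (seg_left _ _) (this ▸ S.p_mem)

lemma BlockerStar.h_pos {A B C : Set (ℝ × ℝ)} {n g h p : ℝ × ℝ} (S : BlockerStar A B C n g h p) :
    0 < h.2 := by
  obtain ⟨s, hs, hs'⟩ := S.cross_h
  obtain ⟨t, ht0, ht1, e1, e2⟩ := mem_seg.1 hs
  obtain ⟨u, hu0, hu1, e3, e4⟩ := mem_seg.1 hs'
  simp at e3 e4
  have hu : u ≠ 0 := by
    rintro rfl
    have : s = (1, 0) := by ext <;> simp [e3, e4]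
    subst this
    exact S.B_nh (S.B_rh.mono (seg_sub S.p_mem (seg_right _ _) hs) (seg_right _ _))
  have hu' : 0 < u := lt_of_le_of_ne hu0 hu.symm
  rw [S.p_two, e4] at e2
  by_contra hc
  nlinarith

/-- The point `h` does not lie in the cone between the root and `g`. Otherwise `C`, which hides `g`
from `(0, 1)` and `h` from the centre, would cross the ray through `g` behind a point of `B`; and
`B`, which hides `h` from the root but not from the centre, would cross the ray through `h` beyond
`h`. These two parts of `B` and `C` would meet. -/
lemma BlockerStar.false_of_det_nonneg {A B C : Set (ℝ × ℝ)} {n g h p : ℝ × ℝ}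
    (S : BlockerStar A B C n g h p) (hD : 0 ≤ det h g) : False := by
  obtain ⟨hg1, hg2, -⟩ := S.g_pos
  have hh2 := S.h_pos
  obtain ⟨b, hb, hgb, hCb⟩ := S.behind_g
  obtain ⟨κ, hκ, rfl⟩ := exists_scale hgb (by rintro rfl; simp at hg1)
  obtain ⟨s, hs0, hs1, hx⟩ := mem_of_hit S.C_mg
  obtain ⟨t, ht0, ht1, hy⟩ := mem_of_hit S.C_h
  obtain ⟨v, hv0, hv1, hβ⟩ := mem_of_hit S.B_rh
  have hs1' := sub_nonneg.2 hs1
  -- `C` crosses the ray through `g`, beyond the point of `B` there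
  have d1 : det ((1 - s) • ((0 : ℝ), (1 : ℝ)) + s • g) g ≤ 0 := by
    rw [det_comb, det_self]
    simp [det]
    exact mul_nonneg hs1' hg1.le
  have d2 : 0 ≤ det ((1 - t) • (0 : ℝ × ℝ) + t • h) g := by
    rw [det_comb]
    simpa [det] using mul_nonneg ht0 hD
  obtain ⟨u, hu0, hu1, hu⟩ := exists_convex_zero d1 d2
  have hu1' := sub_nonneg.2 hu1
  obtain ⟨x, ex⟩ : ∃ x, x = (1 - s) • ((0 : ℝ), (1 : ℝ)) + s • g := ⟨_, rfl⟩
  obtain ⟨y, ey⟩ : ∃ y, y = (1 - t) • (0 : ℝ × ℝ) + t • h := ⟨_, rfl⟩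
  rw [← ex] at hx hu
  rw [← ey] at hy hu
  have hw := S.convC hx hy hu1' hu0 (by ring)
  have ew := eq_smul_of_det_eq_zero hg2 (by rw [det_comb, hu])
  have hω : 0 ≤ ((1 - u) • x + u • y).2 / g.2 := by
    refine div_nonneg ?_ hg2.le
    simp [ex, ey]
    have := mul_nonneg hu1' (add_nonneg hs1' (mul_nonneg hs0 hg2.le))
    have := mul_nonneg hu0 (mul_nonneg ht0 hh2.le)
    linarith
  generalize ((1 - u) • x + u • y).2 / g.2 = ω at ew hω
  have hκω : κ < ω := by
    by_contra hc
    rw [ew] at hw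
    exact hCb ⟨_, seg_ray_zero hω (not_lt.1 hc), hw⟩
  have hω' : 0 < ω := by linarith
  have hκ0 : 0 ≤ κ := by linarith
  have eb : κ • g = (κ / ω * u) • y + (κ / ω * (1 - u)) • x := by
    have : g = ω⁻¹ • ((1 - u) • x + u • y) := by
      rw [ew, smul_smul, inv_mul_cancel₀ hω'.ne', one_smul]
    rw [this]; ext <;> simp <;> ring
  -- `B` crosses the ray through `h`, beyond `h`
  have d3 : det ((1 - v) • ((1 : ℝ), (0 : ℝ)) + v • h) h ≥ 0 := by
    rw [det_comb, det_self]
    simpa [det] using mul_nonneg (sub_nonneg.2 hv1) hh2.le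
  have d4 : det (κ • g) h ≤ 0 := by
    rw [det_smul_left, det_swap h g]
    nlinarith
  obtain ⟨k, hk0, hk1, hk⟩ := exists_convex_zero d4 d3
  have hz := S.convB hb hβ (sub_nonneg.2 hk1) hk0 (by ring)
  have ez := eq_smul_of_det_eq_zero hh2 (by rw [det_comb, hk])
  rw [ez] at hz
  have hδ : 0 ≤ ((1 - k) • κ • g + k • ((1 - v) • ((1 : ℝ), (0 : ℝ)) + v • h)).2 / h.2 := by
    refine div_nonneg ?_ hh2.le
    simp
    have := mul_nonneg (sub_nonneg.2 hk1) (mul_nonneg hκ0 hg2.le)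
    have := mul_nonneg hk0 (mul_nonneg hv0 hh2.le)
    linarith
  generalize ((1 - k) • κ • g + k • ((1 - v) • ((1 : ℝ), (0 : ℝ)) + v • h)).2 / h.2 = δ at hz hδ
  have hδ1 := not_smul_mem S.B_h hδ hz
  have ht : 0 < t := by
    refine lt_of_le_of_ne ht0 ?_
    rintro rfl
    refine S.C_g ⟨y, ?_, hy⟩
    rw [ey]; simpa using seg_left 0 g
  have hκω' : κ / ω ≤ 1 := by rw [div_le_one hω']; exact hκω.le
  have hκω0 : 0 ≤ κ / ω := div_nonneg hκ0 hω'.le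
  obtain ⟨c, hc, hcB⟩ := hit_base_zero S.convB (g := y) (l := x) hb hz (a' := δ / t) (b' := 0)
    (mul_nonneg hκω0 hu0) (mul_nonneg hκω0 hu1') (by linarith) (by positivity) le_rfl
    (by rw [add_zero, one_le_div ht]; linarith) eb
    (by rw [ey]; ext <;> simp <;> field_simp)
  exact Set.disjoint_left.1 S.disj hcB (S.convC.segment_subset hy hx hc)

/-- The point `g` lies in the triangle spanned by the centre `0`, the crossing `p` and `h`. -/
lemma BlockerStar.mem_triangle {A B C : Set (ℝ × ℝ)} {n g h p : ℝ × ℝ}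
    (S : BlockerStar A B C n g h p) :
    ∃ x y : ℝ, 0 ≤ x ∧ 0 ≤ y ∧ x + y ≤ 1 ∧ g = x • p + y • h := by
  have hD : det h g < 0 := by
    by_contra hc
    exact S.false_of_det_nonneg (not_lt.1 hc)
  obtain ⟨hg1, hg2, -⟩ := S.g_pos
  have hh2 := S.h_pos
  have hp1 := S.p_pos
  have hdp : 0 < det p h := by
    rw [det, S.p_two]; nlinarith
  have eg := cramer g hdp.ne'
  have hx : 0 ≤ det g h / det p h := div_nonneg (by rw [det_swap]; linarith) hdp.le
  have hy : 0 ≤ det p g / det p h := by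
    refine div_nonneg ?_ hdp.le
    rw [det, S.p_two]; nlinarith
  refine ⟨_, _, hx, hy, ?_, eg⟩
  generalize det g h / det p h = x at *
  generalize det p g / det p h = y at *
  by_contra hc
  have hxy := not_le.1 hc
  have hxy0 : 0 < x + y := by linarith
  -- otherwise the segments `[0, g]` and `[n, h]` cross, and nothing hides `g` from `n`
  have hs : (x + y)⁻¹ • g ∈ segment ℝ p h := by
    have := seg_comb (u := p) (v := h) (div_nonneg hx hxy0.le) (div_nonneg hy hxy0.le)
      (by field_simp)
    convert this using 1
    rw [eg]; ext <;> simp <;> ring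
  have hs0 : (x + y)⁻¹ • g ∈ segment ℝ 0 g :=
    seg_ray_one (inv_nonneg.2 hxy0.le) (inv_le_one_of_one_le₀ hxy.le)
  have hsn : (x + y)⁻¹ • g ∈ segment ℝ n h := seg_sub S.p_mem (seg_right _ _) hs
  generalize (x + y)⁻¹ • g = s at hs hs0 hsn
  rcases S.split with h1 | h1 | h1
  · exact S.A_nh ((hit_cevian S.convA S.A_n h1 hs0).mono (seg_left _ _) hsn)
  · obtain ⟨b, hb, hhb⟩ := S.behind_h
    exact S.B_g ((hit_of_shadow S.convB hb (seg_sub (seg_left _ _) hhb hsn) h1).mono hs0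
      (seg_right _ _))
  · exact S.C_nh (hit_diagonal S.convC hsn (seg_symm hs0) h1 (hit_comm S.C_h))

/-- As `g` and `g'` lie in the triangle spanned by `0`, `p` and `h`, so does a point of `B` between
them, while `B` also has a point behind `h`; hence `B` crosses the segment from `0` to `h`. -/
lemma BlockerStar.elim {A B C : Set (ℝ × ℝ)} {n g g' h p : ℝ × ℝ} (S : BlockerStar A B C n g h p)
    (S' : BlockerStar A B C n g' h p) (hgg : Hit B g g') : False := by
  obtain ⟨x, y, hx, hy, hxy, e⟩ := S.mem_triangle
  obtain ⟨x', y', hx', hy', hxy', e'⟩ := S'.mem_triangle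
  obtain ⟨t, ht0, ht1, hw⟩ := mem_of_hit hgg
  obtain ⟨b, hb, hhb⟩ := S.behind_h
  -- `h` lies between `p` and the point `b` of `B`
  have hhp : h ∈ segment ℝ p b := by
    obtain ⟨u, hu0, hu1, p1, p2⟩ := mem_seg.1 S.p_mem
    obtain ⟨v, hv0, hv1, h1, h2⟩ := mem_seg.1 hhb
    have hne : 1 - u * v ≠ 0 := by
      intro h0
      have hu : u = 1 := by nlinarith
      subst hu
      have := S.h_pos
      have := S.p_two
      linarith
    have hpos : 0 < 1 - u * v := lt_of_le_of_ne (by nlinarith) hne.symm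
    have hd := inv_mul_cancel₀ hne
    have hi : 0 ≤ (1 - u * v)⁻¹ := (inv_pos.2 hpos).le
    refine mem_seg.2 ⟨v * (1 - u) * (1 - u * v)⁻¹,
      mul_nonneg (mul_nonneg hv0 (sub_nonneg.2 hu1)) hi, ?_, ?_, ?_⟩
    · rw [← div_eq_mul_inv, div_le_one hpos]; nlinarith
    · rw [p1, h1]
      linear_combination (v * (1 - u) * (n.1 - b.1)) * hd
    · rw [p2, h2]
      linear_combination (v * (1 - u) * (n.2 - b.2)) * hd
  obtain ⟨v, hv0, hv1, h1, h2⟩ := mem_seg.1 hhp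
  have hv : v ≠ 0 := by
    rintro rfl
    have := S.h_pos
    have := S.p_two
    linarith
  have hv' : 0 < v := lt_of_le_of_ne hv0 hv.symm
  have ht1' := sub_nonneg.2 ht1
  refine S.B_h (hit_base S.convB (c := p) hw hb
    (a := 1 - ((1 - t) * x + t * x') - ((1 - t) * y + t * y'))
    (b := (1 - t) * y + t * y') (a' := 0) (b' := v⁻¹) ?_ (by positivity) ?_ le_rfl
    (inv_nonneg.2 hv0) (by rw [zero_add]; exact one_le_inv_iff₀.2 ⟨hv', hv1⟩) ?_ ?_)
  · nlinarith [mul_nonneg ht1' (sub_nonneg.2 hxy), mul_nonneg ht0 (sub_nonneg.2 hxy')]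
  · have := mul_nonneg ht1' hx
    have := mul_nonneg ht0 hx'
    linarith
  · rw [e, e']; ext <;> simp <;> ring
  · ext
    · simp; field_simp; linarith
    · simp; field_simp; linarith

/-! ### Configurations with three obstacles -/

/-- None of the obstacles meets the segment `[p, q]`. -/
def Seen (O : Fin 3 → Set (ℝ × ℝ)) (p q : ℝ × ℝ) : Prop := ∀ k, ¬ Hit (O k) p q

/-- Three children `c₀`, `c₁`, `c₂` of the root `r`, pairwise separated by the obstacle `O A`,
which reaches behind `c₁` as seen from `r`. The point `c₁` lies in the angle between `c₀` and `c₂`. -/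
structure RootStar (O : Fin 3 → Set (ℝ × ℝ)) (A : Fin 3) (r c₀ c₁ c₂ : ℝ × ℝ) : Prop where
  conv : ∀ k, Convex ℝ (O k)
  disj : ∀ i j, i ≠ j → Disjoint (O i) (O j)
  see₀ : Seen O r c₀
  see₁ : Seen O r c₁
  see₂ : Seen O r c₂
  hit₁₀ : Hit (O A) c₁ c₀
  hit₂₀ : Hit (O A) c₂ c₀
  hit₂₁ : Hit (O A) c₂ c₁
  behind₁ : ∃ a ∈ O A, c₁ ∈ segment ℝ r a
  between : ∃ α β : ℝ, 0 ≤ α ∧ 0 ≤ β ∧ c₁ - r = α • (c₀ - r) + β • (c₂ - r)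

/-- Two neighbours `g` and `h` of a child `c` of the root `r`, hidden from `r` by `O B` and separated
by `O X`, which reaches behind both of them as seen from `c`, together with a leaf `l` at `h` whose
edge crosses that from `c` to `g`. -/
structure ChildStar (O : Fin 3 → Set (ℝ × ℝ)) (B X : Fin 3) (r c g h l : ℝ × ℝ) : Prop where
  see_g : Seen O c g
  see_h : Seen O c h
  see_l : Seen O h l
  hit_rg : Hit (O B) r g
  hit_rh : Hit (O B) r h
  hit_gh : Hit (O X) g h
  behind_g : ∃ z ∈ O X, g ∈ segment ℝ c z ∧ ∀ k, k ≠ X → ¬ Hit (O k) c z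
  behind_h : ∃ z ∈ O X, h ∈ segment ℝ c z ∧ ∀ k, k ≠ X → ¬ Hit (O k) c z
  cross_l : Cross h l c g
  hid_rl : ¬ Seen O r l
  hid_cl : ¬ Seen O c l
  hid_gl : ¬ Seen O g l

/-- The child `m` of the root `r` does not see a neighbour `g` of another child `c`, and the edges
`r m` and `c g` cross. -/
structure Overlap (O : Fin 3 → Set (ℝ × ℝ)) (r m c g : ℝ × ℝ) : Prop where
  hid : ¬ Seen O m g
  cross : Cross c g r m

lemma not_seen {O : Fin 3 → Set (ℝ × ℝ)} {p q : ℝ × ℝ} (h : ¬ Seen O p q) {A B C : Fin 3}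
    (hAB : A ≠ B) (hAC : A ≠ C) (hBC : B ≠ C) : Hit (O A) p q ∨ Hit (O B) p q ∨ Hit (O C) p q := by
  simp only [Seen, not_forall, not_not] at h
  obtain ⟨k, hk⟩ := h
  have : k = A ∨ k = B ∨ k = C := by omega
  rcases this with rfl | rfl | rfl
  · exact .inl hk
  · exact .inr (.inl hk)
  · exact .inr (.inr hk)

lemma exists_third {A B : Fin 3} (h : A ≠ B) : ∃ C, A ≠ C ∧ B ≠ C := by
  revert A B; decide

lemma det_sub_ne_zero {X : Set (ℝ × ℝ)} {o u v : ℝ × ℝ} (h : Hit X u v) (hu : ¬ Hit X o u)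
    (hv : ¬ Hit X o v) : det (u - o) (v - o) ≠ 0 := by
  obtain ⟨F, hF⟩ := exists_affineEquiv o (a := 1) (b := 0) (c := 0) (d := 1) (by norm_num)
  have e : ∀ x, F x = x - o := fun x => by rw [hF]; ext <;> simp
  have e0 : F o = 0 := by rw [e, sub_self]
  rw [← e, ← e]
  exact det_ne_zero_of_hit ((hit_map F).2 h) (by rwa [← e0, hit_map]) (by rwa [← e0, hit_map])

lemma seg_total {x y p q : ℝ × ℝ} (hx : x ∈ segment ℝ p q) (hy : y ∈ segment ℝ p q) :
    x ∈ segment ℝ p y ∨ y ∈ segment ℝ p x := by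
  have key : ∀ s t : ℝ, 0 ≤ s → s ≤ t → (1 - s) • p + s • q ∈ segment ℝ p ((1 - t) • p + t • q) := by
    intro s t hs hst
    rcases eq_or_lt_of_le (hs.trans hst) with h | h
    · have : s = 0 := by linarith
      subst this
      simpa using seg_left _ _
    · refine mem_seg.2 ⟨s / t, div_nonneg hs h.le, (div_le_one h).2 hst, ?_, ?_⟩ <;>
      · simp; field_simp; ring
  have co : ∀ {z}, z ∈ segment ℝ p q → ∃ t : ℝ, 0 ≤ t ∧ z = (1 - t) • p + t • q := by
    intro z hz
    obtain ⟨t, h0, -, e1, e2⟩ := mem_seg.1 hz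
    exact ⟨t, h0, by ext <;> simp [e1, e2]⟩
  obtain ⟨s, hs, rfl⟩ := co hx
  obtain ⟨t, ht, rfl⟩ := co hy
  rcases le_total s t with h | h
  · exact .inl (key s t hs h)
  · exact .inr (key t s ht h)

/-- A segment from `w` meets rays from `r` in the order of their angles. -/
lemma mem_seg_of_between {r u v w h p s : ℝ × ℝ} {α β : ℝ} (hd : det (u - r) (w - r) ≠ 0)
    (hβ : 0 ≤ β) (e : v - r = α • (u - r) + β • (w - r)) (hs : s ∈ segment ℝ w h)
    (hs' : s ∈ segment ℝ r u) (hp : p ∈ segment ℝ w h) (hp' : p ∈ segment ℝ r v) :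
    p ∈ segment ℝ w s := by
  rcases seg_total hp hs with h1 | h1
  · exact h1
  obtain ⟨t, ht0, ht1, e1, e2⟩ := mem_seg.1 h1
  obtain ⟨ρ, hρ0, -, e3, e4⟩ := mem_seg.1 hp'
  obtain ⟨σ, -, -, e5, e6⟩ := mem_seg.1 hs'
  have e7 := congrArg Prod.fst e
  have e8 := congrArg Prod.snd e
  simp at e7 e8
  have key : ((1 - t) + t * ρ * β) * det (u - r) (w - r) = 0 := by
    simp only [det, Prod.fst_sub, Prod.snd_sub]
    linear_combination (u.2 - r.2) * e1 - (u.1 - r.1) * e2 + t * (u.2 - r.2) * e3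
      - t * (u.1 - r.1) * e4 - (u.2 - r.2) * e5 + (u.1 - r.1) * e6
      + t * ρ * (u.2 - r.2) * e7 - t * ρ * (u.1 - r.1) * e8
  have h2 := (mul_eq_zero.1 key).resolve_right hd
  have h3 : 0 ≤ t * ρ * β := by positivity
  have : t = 1 := by linarith
  subst this
  have : s = p := by ext <;> simp [e1, e2]
  exact this ▸ seg_right _ _

section

variable {O : Fin 3 → Set (ℝ × ℝ)} {A B C : Fin 3} {r m c g : ℝ × ℝ}

/-- The obstacle behind a child of the root hides no neighbour of that child from the root. -/
lemma not_hit_root (hO : ∀ k, Convex ℝ (O k)) (hc : ∃ a ∈ O A, c ∈ segment ℝ r a)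
    (hg : Seen O c g) : ¬ Hit (O A) r g := by
  obtain ⟨a, ha, h⟩ := hc
  exact fun h1 => hg A (hit_of_shadow (hO A) ha h h1)

/-- The obstacle that separates the children of the root does not hide `g` from `m`. -/
lemma Overlap.not_hit (h : Overlap O r m c g) (hO : ∀ k, Convex ℝ (O k)) (hm : Seen O r m)
    (hA : Hit (O A) c m) : ¬ Hit (O A) m g := by
  obtain ⟨p, hp, hp'⟩ := h.cross
  intro h1
  exact hm A ((hit_cevian (hO A) h1 (hit_comm hA) (seg_symm hp)).mono (seg_right _ _) hp')

/-- The obstacle that hides `g` from the root does not hide it from `m`. -/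
lemma Overlap.not_hit' (h : Overlap O r m c g) (hO : ∀ k, Convex ℝ (O k)) (hg : Seen O c g)
    (hB : Hit (O B) r g) : ¬ Hit (O B) m g := by
  obtain ⟨p, hp, hp'⟩ := h.cross
  intro h1
  exact hg B ((hit_cevian (hO B) (hit_comm hB) (hit_comm h1) hp').mono (seg_right _ _) hp)

/-- Hence the third obstacle hides `g` from `m`. -/
lemma Overlap.hit (h : Overlap O r m c g) (hO : ∀ k, Convex ℝ (O k)) (hAB : A ≠ B) (hAC : A ≠ C)
    (hBC : B ≠ C) (hm : Seen O r m) (hA : Hit (O A) c m) (hg : Seen O c g) (hB : Hit (O B) r g) :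
    Hit (O C) m g := by
  rcases not_seen h.hid hAB hAC hBC with h1 | h1 | h1
  · exact absurd h1 (h.not_hit hO hm hA)
  · exact absurd h1 (h.not_hit' hO hg hB)
  · exact h1

/-- The obstacle that separates the children of the root has no point behind a neighbour of a child,
so it does not separate such neighbours. -/
lemma Overlap.false_of_behind (h : Overlap O r m c g) (hO : ∀ k, Convex ℝ (O k)) (hm : Seen O r m)
    (hA : Hit (O A) c m) (hg : ∃ z ∈ O A, g ∈ segment ℝ c z) : False := by
  obtain ⟨p, hp, hp'⟩ := h.cross
  obtain ⟨z, hz, hgz⟩ := hg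
  exact hm A ((hit_of_shadow (hO A) hz (seg_sub (seg_left _ _) hgz hp) hA).mono hp' (seg_right _ _))

lemma Overlap.pos (h : Overlap O r m c g) (hg : Seen O c g) (hB : Hit (O B) r g)
    (hA : Hit (O A) c m) {F : (ℝ × ℝ) ≃ᵃ[ℝ] (ℝ × ℝ)} (Fc : 0 = F c) (Fr : (1, 0) = F r)
    (Fm : (0, 1) = F m) : 0 < (F g).1 ∧ 0 < (F g).2 ∧ 1 ≤ (F g).1 + (F g).2 := by
  refine pos_of_cross ?_ ?_ ?_
  · rw [Fc, Fr, Fm, cross_map]; exact h.cross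
  · rw [Fc, Fr, mem_seg_map]
    exact fun h1 => hg B (hB.mono h1 (seg_right _ _))
  · rw [Fc, Fm, mem_seg_map]
    exact fun h1 => hg A (hA.mono (seg_left _ _) h1)

end

section

variable {O : Fin 3 → Set (ℝ × ℝ)} {A B C : Fin 3} {r c₀ c₁ c₂ g h l g' h' l' : ℝ × ℝ}

/-- Coordinates that take `c₁` to the origin and `r`, `c₀` to the standard basis. -/
lemma RootStar.exists_frame (R : RootStar O A r c₀ c₁ c₂) :
    ∃ F : (ℝ × ℝ) ≃ᵃ[ℝ] (ℝ × ℝ), 0 = F c₁ ∧ (1, 0) = F r ∧ (0, 1) = F c₀ := by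
  have hd := det_sub_ne_zero R.hit₁₀ (R.see₁ A) (R.see₀ A)
  have : det (r - c₁) (c₀ - c₁) ≠ 0 := by
    intro h0
    apply hd
    simp only [det, Prod.fst_sub, Prod.snd_sub] at h0 ⊢
    linear_combination -h0
  obtain ⟨F, h1, h2, h3⟩ := _root_.exists_frame this
  exact ⟨F, h1.symm, h2.symm, h3.symm⟩

lemma Disjoint.image_affine {X Y : Set (ℝ × ℝ)} (h : Disjoint X Y) (F : (ℝ × ℝ) ≃ᵃ[ℝ] (ℝ × ℝ)) :
    Disjoint (F '' X) (F '' Y) := (Set.disjoint_image_iff F.injective).2 h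

lemma RootStar.blockerStar (R : RootStar O A r c₀ c₁ c₂) (hAB : A ≠ B) (hAC : A ≠ C) (hBC : B ≠ C)
    (hg : Seen O c₁ g) (hrg : Hit (O B) r g)
    (hbg : ∃ z ∈ O B, g ∈ segment ℝ c₁ z ∧ ∀ k, k ≠ B → ¬ Hit (O k) c₁ z)
    (hh : Seen O c₂ h) (hrh : Hit (O B) r h) (hbh : ∃ z ∈ O B, h ∈ segment ℝ c₂ z)
    (V : Overlap O r c₀ c₁ g) {p : ℝ × ℝ} (hp : p ∈ segment ℝ c₂ h)
    (hp' : p ∈ segment ℝ r c₁) (hph : Cross p h r c₀) (hid : ¬ Seen O c₂ g)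
    (V₁ : Overlap O r c₁ c₂ h) {F : (ℝ × ℝ) ≃ᵃ[ℝ] (ℝ × ℝ)} (F1 : 0 = F c₁)
    (Fr : (1, 0) = F r) (F0 : (0, 1) = F c₀) :
    BlockerStar (F '' O A) (F '' O B) (F '' O C) (F c₂) (F g) (F h) (F p) := by
  have hFp := (mem_seg_map F).2 hp'
  rw [← F1, ← Fr] at hFp
  obtain ⟨t, ht0, ht1, e1, e2⟩ := mem_seg.1 hFp
  simp at e1 e2
  refine
  { convA := convex_map F (R.conv A), convB := convex_map F (R.conv B)
    convC := convex_map F (R.conv C), disj := (R.disj _ _ hBC).image_affine F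
    p_mem := (mem_seg_map F).2 hp, p_one := by linarith, p_two := e2
    cross_h := ?_, g_pos := V.pos hg hrg R.hit₁₀ F1 Fr F0, A_n := ?_, A_nh := ?_, B_nh := ?_, B_g := ?_, B_h := ?_, B_rh := ?_, behind_g := ?_, behind_h := ?_, C_nh := ?_
    C_g := ?_, C_h := ?_, C_mg := ?_, split := ?_ } <;>
    try simp only [F1, Fr, F0, cross_map, hit_map]
  · exact hph
  · exact R.hit₂₁
  · exact hh A
  · exact hh B
  · exact hg B
  · exact V₁.not_hit' R.conv hh hrh
  · exact hrh
  · obtain ⟨z, hz, h1, h2⟩ := hbg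
    exact ⟨F z, ⟨z, hz, rfl⟩, (mem_seg_map F).2 h1, by rw [hit_map]; exact h2 C hBC.symm⟩
  · obtain ⟨z, hz, h1⟩ := hbh
    exact ⟨F z, ⟨z, hz, rfl⟩, (mem_seg_map F).2 h1⟩
  · exact hh C
  · exact hg C
  · exact V₁.hit R.conv hAB hAC hBC R.see₁ R.hit₂₁ hh hrh
  · exact V.hit R.conv hAB hAC hBC R.see₀ R.hit₁₀ hg hrg
  · exact not_seen hid hAB hAC hBC

/-- The obstacle that hides the grandchildren from the root does not separate the neighbours of the
children. -/
lemma RootStar.false_of_blockerStar (R : RootStar O A r c₀ c₁ c₂) (hAB : A ≠ B)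
    (S : ChildStar O B B r c₁ g h l) (S' : ChildStar O B B r c₂ g' h' l')
    (Vg : Overlap O r c₀ c₁ g) (Vh : Overlap O r c₀ c₁ h) (V₀ : Overlap O r c₀ c₂ h')
    (V₁ : Overlap O r c₁ c₂ h') (hidg : ¬ Seen O c₂ g) (hidh : ¬ Seen O c₂ h) : False := by
  obtain ⟨C, hAC, hBC⟩ : ∃ C : Fin 3, A ≠ C ∧ B ≠ C := exists_third hAB
  have hbh' : ∃ z ∈ O B, h' ∈ segment ℝ c₂ z := by
    obtain ⟨z, hz, h1, -⟩ := S'.behind_h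
    exact ⟨z, hz, h1⟩
  obtain ⟨F, F1, Fr, F0⟩ := R.exists_frame
  obtain ⟨α, β, hα, hβ, e⟩ := R.between
  obtain ⟨s, hs, hs'⟩ := V₀.cross
  obtain ⟨p, hp, hp'⟩ := V₁.cross
  have hd : det (c₀ - r) (c₂ - r) ≠ 0 :=
    det_sub_ne_zero (hit_comm R.hit₂₀) (R.see₀ A) (R.see₂ A)
  have hps := mem_seg_of_between hd hβ e hs hs' hp hp'
  have hsp : Cross p h' r c₀ := by
    rw [mem_segment_iff_wbtw] at hps
    exact ⟨s, mem_segment_iff_wbtw.2 ((mem_segment_iff_wbtw.1 hs).trans_left_right hps), hs'⟩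
  exact (R.blockerStar hAB hAC hBC S.see_g S.hit_rg S.behind_g S'.see_h S'.hit_rh hbh' Vg hp
    hp' hsp hidg V₁ F1 Fr F0).elim (R.blockerStar hAB hAC hBC S.see_h S.hit_rh S.behind_h S'.see_h S'.hit_rh
    hbh' Vh hp hp' hsp hidh V₁ F1 Fr F0) ((hit_map F).2 S.hit_gh)

/-- The edge of the leaf does not cross the edge from the root to the other child. -/
lemma ChildStar.not_cross (S : ChildStar O B C r c₁ g h l) (hO : ∀ k, Convex ℝ (O k)) (hAB : A ≠ B)
    (hAC : A ≠ C) (hBC : B ≠ C) (hm : Seen O r c₀) (hC : Hit (O C) c₀ h) (hl : ¬ Seen O c₀ l) :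
    ¬ Cross h l r c₀ := by
  rintro ⟨k, hk, hk'⟩
  have h1 : Hit (O A) r l := by
    rcases not_seen S.hid_rl hAB hAC hBC with h1 | h1 | h1
    · exact h1
    · exact absurd ((hit_cevian (hO B) S.hit_rh h1 hk).mono (seg_left _ _) hk') (hm B)
    · exact absurd (hit_diagonal (hO C) hk' (seg_symm hk) h1 hC) (hm C)
  have h2 : Hit (O A) c₀ l := by
    rcases not_seen hl hAB hAC hBC with h2 | h2 | h2
    · exact h2
    · exact absurd (hit_diagonal (hO B) hk' hk S.hit_rh h2) (hm B)
    · exact absurd ((hit_cevian (hO C) hC h2 hk).mono (seg_right _ _) hk') (hm C)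
  exact S.see_l A ((hit_cevian (hO A) (hit_comm h1) (hit_comm h2) hk').mono (seg_right _ _) hk)

/-- The leaf is hidden from `c` and from `g` by the two other obstacles, one each. -/
lemma ChildStar.split (S : ChildStar O B C r c₁ g h l) (hO : ∀ k, Convex ℝ (O k)) (hAB : A ≠ B)
    (hAC : A ≠ C) (hBC : B ≠ C) :
    (Hit (O A) c₁ l ∧ Hit (O B) g l) ∨ (Hit (O B) c₁ l ∧ Hit (O A) g l) := by
  obtain ⟨q, hq, hq'⟩ := S.cross_l
  obtain ⟨z, hz, hhz, -⟩ := S.behind_h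
  have both : ∀ k, Hit (O k) c₁ l → ¬ Hit (O k) g l := fun k h1 h2 =>
    S.see_l k ((hit_cevian (hO k) (hit_comm h1) (hit_comm h2) hq').mono (seg_right _ _) hq)
  have h1 : ¬ Hit (O C) c₁ l := fun h1 => S.see_l C (hit_of_shadow (hO C) hz hhz h1)
  have h2 : ¬ Hit (O C) g l := fun h2 =>
    S.see_g C ((hit_cevian (hO C) S.hit_gh h2 hq).mono (seg_right _ _) hq')
  rcases not_seen S.hid_cl hAB hAC hBC with h3 | h3 | h3
  · rcases not_seen S.hid_gl hAB hAC hBC with h4 | h4 | h4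
    · exact absurd h4 (both A h3)
    · exact .inl ⟨h3, h4⟩
    · exact absurd h4 h2
  · rcases not_seen S.hid_gl hAB hAC hBC with h4 | h4 | h4
    · exact .inr ⟨h3, h4⟩
    · exact absurd h4 (both B h3)
    · exact absurd h4 h2
  · exact absurd h3 h1

/-- The third obstacle does not separate the neighbours of the children either. -/
lemma RootStar.false_of_thirdStar (R : RootStar O A r c₀ c₁ c₂) (hAB : A ≠ B) (hAC : A ≠ C)
    (hBC : B ≠ C) (S : ChildStar O B C r c₁ g h l) (Vg : Overlap O r c₀ c₁ g)
    (Vh : Overlap O r c₀ c₁ h) (hl : ¬ Seen O c₀ l) : False := by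
  obtain ⟨F, F1, Fr, F0⟩ := R.exists_frame
  have hC := Vh.hit R.conv hAB hAC hBC R.see₀ R.hit₁₀ S.see_h S.hit_rh
  have L : ThirdStar (F '' O A) (F '' O B) (F '' O C) (F g) (F h) (F l) := by
    refine
    { convA := convex_map F (R.conv A), convB := convex_map F (R.conv B)
      convC := convex_map F (R.conv C), disj := (R.disj _ _ hBC).image_affine F
      cross_h := ?_, cross_l := ?_, no_cross := ?_
      g_pos := Vg.pos S.see_g S.hit_rg R.hit₁₀ F1 Fr F0
      h_pos := Vh.pos S.see_h S.hit_rh R.hit₁₀ F1 Fr F0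
      A_m := ?_, A_behind := ?_, A_root := ?_, A_g := ?_, A_mg := ?_, A_hl := ?_, B_g := ?_
      B_h := ?_, B_mg := ?_, B_mh := ?_, B_hl := ?_, B_rg := ?_, B_rh := ?_, C_hl := ?_
      C_mh := ?_, C_g := ?_, C_h := ?_, split := ?_ } <;>
      try simp only [F1, Fr, F0, cross_map, hit_map]
    · exact Vh.cross
    · exact S.cross_l
    · exact S.not_cross R.conv hAB hAC hBC R.see₀ hC hl
    · exact R.hit₁₀
    · obtain ⟨a, ha, h1⟩ := R.behind₁
      exact ⟨F a, ⟨a, ha, rfl⟩, (mem_seg_map F).2 h1⟩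
    · exact R.see₀ A
    · exact S.see_g A
    · exact Vg.not_hit R.conv R.see₀ R.hit₁₀
    · exact S.see_l A
    · exact S.see_g B
    · exact S.see_h B
    · exact Vg.not_hit' R.conv S.see_g S.hit_rg
    · exact Vh.not_hit' R.conv S.see_h S.hit_rh
    · exact S.see_l B
    · exact S.hit_rg
    · exact S.hit_rh
    · exact S.see_l C
    · exact hC
    · obtain ⟨z, hz, h1, h2⟩ := S.behind_g
      exact ⟨F z, ⟨z, hz, rfl⟩, (mem_seg_map F).2 h1, by rw [hit_map]; exact h2 B hBC⟩
    · obtain ⟨z, hz, h1, -⟩ := S.behind_h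
      exact ⟨F z, ⟨z, hz, rfl⟩, (mem_seg_map F).2 h1⟩
    · exact S.split R.conv hAB hAC hBC
  refine L.elim (det_ne_zero_of_hit ((hit_map F).2 (hit_comm S.hit_gh)) ?_ ?_)
  · rw [F1, hit_map]; exact S.see_h C
  · rw [F1, hit_map]; exact S.see_g C

/-- Stars of the same kind cannot occur at both `c₁` and `c₂`, whichever of the three obstacles
separates their points. -/
theorem RootStar.elim (R : RootStar O A r c₀ c₁ c₂) (hAB : A ≠ B) {X : Fin 3}
    (S : ChildStar O B X r c₁ g h l) (S' : ChildStar O B X r c₂ g' h' l')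
    (Vg : Overlap O r c₀ c₁ g) (Vh : Overlap O r c₀ c₁ h) (V₀ : Overlap O r c₀ c₂ h')
    (V₁ : Overlap O r c₁ c₂ h') (hg : ¬ Seen O c₂ g) (hh : ¬ Seen O c₂ h)
    (hl : ¬ Seen O c₀ l) : False := by
  by_cases hA : X = A
  · subst hA
    obtain ⟨z, hz, hgz, -⟩ := S.behind_g
    exact Vg.false_of_behind R.conv R.see₀ R.hit₁₀ ⟨z, hz, hgz⟩
  by_cases hB : X = B
  · subst hB
    exact R.false_of_blockerStar hAB S S' Vg Vh V₀ V₁ hg hh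
  · exact R.false_of_thirdStar hAB (Ne.symm hA) (Ne.symm hB) S Vg Vh hl

end

/-! ### Ramsey's theorem for three colours -/

/-- A finite form of Ramsey's theorem for three colours, with prescribed sizes `w c` of the
monochromatic sets. An edge may have several colours. -/
lemma exists_ramsey_weights (s : ℕ) : ∀ w : Fin 3 → ℕ, ∑ c, w c = s → ∃ N : ℕ, ∀ {ι : Type}
    (S : Finset ι) (R : Fin 3 → ι → ι → Prop), (∀ c x y, R c x y → R c y x) → N ≤ S.card →
    (∀ x ∈ S, ∀ y ∈ S, x ≠ y → ∃ c, R c x y) →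
    ∃ c, ∃ T ⊆ S, w c ≤ T.card ∧ ∀ x ∈ T, ∀ y ∈ T, x ≠ y → R c x y := by
  classical
  induction s with
  | zero =>
    intro w hw
    refine ⟨0, fun S R _ _ _ => ⟨0, ∅, by simp, ?_, by simp⟩⟩
    have := Finset.single_le_sum (fun c _ => Nat.zero_le (w c)) (Finset.mem_univ (0 : Fin 3))
    omega
  | succ s ih =>
    intro w hw
    by_cases h0 : ∃ c, w c = 0
    · obtain ⟨c, hc⟩ := h0
      exact ⟨0, fun S R _ _ _ => ⟨c, ∅, by simp, by simp [hc], by simp⟩⟩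
    push Not at h0
    have hN : ∀ c, ∑ c', Function.update w c (w c - 1) c' = s := by
      intro c
      have := h0 c
      rw [Finset.sum_update_of_mem (Finset.mem_univ c)]
      have := Finset.add_sum_erase Finset.univ w (Finset.mem_univ c)
      rw [Finset.sdiff_singleton_eq_erase]
      omega
    choose N hN using fun c => ih _ (hN c)
    refine ⟨3 * ∑ c, N c + 1, fun {ι} S R hR hS h => ?_⟩
    obtain ⟨x, hx⟩ := Finset.card_pos.1 (show 0 < S.card by omega)
    have hcol : ∀ y, ∃ c, y ∈ S.erase x → R c x y := by
      intro y
      by_cases hy : y ∈ S.erase x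
      · obtain ⟨c, hc⟩ := h x hx y (Finset.mem_of_mem_erase hy) (Finset.ne_of_mem_erase hy).symm
        exact ⟨c, fun _ => hc⟩
      · exact ⟨0, fun h => absurd h hy⟩
    choose col hcol using hcol
    obtain ⟨c, -, hc⟩ := Finset.exists_le_card_fiber_of_mul_le_card_of_maps_to
      (s := S.erase x) (t := Finset.univ) (f := col) (n := ∑ c, N c) (fun _ _ => Finset.mem_univ _)
      Finset.univ_nonempty (by rw [Finset.card_erase_of_mem hx]; simp; omega)
    have hsub : (S.erase x).filter (col · = c) ⊆ S :=
      (Finset.filter_subset _ _).trans (Finset.erase_subset _ _)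
    obtain ⟨c', T, hT, hTc, hTR⟩ := hN c ((S.erase x).filter (col · = c)) R hR
      ((Finset.single_le_sum (fun c _ => Nat.zero_le (N c)) (Finset.mem_univ c)).trans hc)
      (fun y hy z hz => h y (hsub hy) z (hsub hz))
    by_cases hcc : c' = c
    · subst hcc
      rw [Function.update_self] at hTc
      have hxT : x ∉ T := fun hxT => by simpa using hT hxT
      have hTx : ∀ y ∈ T, R c' x y := by
        intro y hy
        have := Finset.mem_filter.1 (hT hy)
        exact this.2 ▸ hcol y this.1
      refine ⟨c', insert x T, Finset.insert_subset hx (hT.trans hsub), ?_, ?_⟩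
      · rw [Finset.card_insert_of_notMem hxT]; omega
      · intro y hy z hz hyz
        rcases Finset.mem_insert.1 hy with e | hy' <;> rcases Finset.mem_insert.1 hz with e' | hz'
        · exact absurd (e.trans e'.symm) hyz
        · exact e ▸ hTx z hz'
        · exact e' ▸ hR _ _ _ (hTx y hy')
        · exact hTR y hy' z hz' hyz
    · rw [Function.update_of_ne hcc] at hTc
      exact ⟨c', T, hT.trans hsub, hTc, hTR⟩

lemma exists_ramsey (n : ℕ) : ∃ N : ℕ, ∀ {ι : Type}
    (S : Finset ι) (R : Fin 3 → ι → ι → Prop), (∀ c x y, R c x y → R c y x) → N ≤ S.card →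
    (∀ x ∈ S, ∀ y ∈ S, x ≠ y → ∃ c, R c x y) →
    ∃ c, ∃ T ⊆ S, n ≤ T.card ∧ ∀ x ∈ T, ∀ y ∈ T, x ≠ y → R c x y := by
  simpa using exists_ramsey_weights _ (fun _ => n) rfl

/-! ### Four levels of the tree -/

/-- What a representation by the three obstacles `O` says about the root `r` of a tree, its
children `c i`, their children `g i j`, and one further child `l i j` of each of these. -/
structure Drawing (O : Fin 3 → Set (ℝ × ℝ)) {κ : Type} (r : ℝ × ℝ) (c : κ → ℝ × ℝ)
    (g l : κ → κ → ℝ × ℝ) : Prop where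
  conv : ∀ k, Convex ℝ (O k)
  closed : ∀ k, IsClosed (O k)
  disj : ∀ i j, i ≠ j → Disjoint (O i) (O j)
  see_c : ∀ i, Seen O r (c i)
  see_g : ∀ i j, Seen O (c i) (g i j)
  see_l : ∀ i j, Seen O (g i j) (l i j)
  hid_cc : ∀ i i', i ≠ i' → ¬ Seen O (c i) (c i')
  hid_rg : ∀ i j, ¬ Seen O r (g i j)
  hid_cg : ∀ i i' j, i ≠ i' → ¬ Seen O (c i) (g i' j)
  hid_gg : ∀ i j j', j ≠ j' → ¬ Seen O (g i j) (g i j')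
  hid_rl : ∀ i j, ¬ Seen O r (l i j)
  hid_cl : ∀ i i' j, ¬ Seen O (c i) (l i' j)
  hid_gl : ∀ i j j', j ≠ j' → ¬ Seen O (g i j) (l i j')

/-- Ramsey's theorem and the sorting of stars together: among many points seen from `o` that do not
see each other, there are `n` sorted ones that are pairwise separated by the same obstacle. -/
lemma exists_sorted_star (n : ℕ) : ∃ N : ℕ, ∀ {ι : Type} {O : Fin 3 → Set (ℝ × ℝ)} {o : ℝ × ℝ}
    {d : ι → ℝ × ℝ} {S : Finset ι}, (∀ k, Convex ℝ (O k)) → (∀ k, IsClosed (O k)) →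
    (∀ i j, i ≠ j → Disjoint (O i) (O j)) → (∀ i ∈ S, Seen O o (d i)) →
    (∀ i ∈ S, ∀ j ∈ S, i ≠ j → ¬ Seen O (d i) (d j)) → N ≤ S.card →
    ∃ X, ∃ f : Fin n → ι, Function.Injective f ∧ (∀ i, f i ∈ S) ∧
      (∀ i j, i ≠ j → Hit (O X) (d (f i)) (d (f j))) ∧
      (∀ i, ∃ a ∈ O X, d (f i) ∈ segment ℝ o a ∧ ∀ k, k ≠ X → ¬ Hit (O k) o a) ∧
      (∀ l m r : Fin n, l < m → m < r → ∃ α β : ℝ, 0 ≤ α ∧ 0 ≤ β ∧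
        d (f m) - o = α • (d (f l) - o) + β • (d (f r) - o)) ∧
      ∀ i e, Seen O (d (f i)) e → ¬ Seen O o e →
        (∀ m < i, Cross (d (f i)) e o (d (f m))) ∨
          (∀ m, i < m → Cross (d (f i)) e o (d (f m))) := by
  obtain ⟨N, hN⟩ := exists_ramsey (3 * (n + 2) + 4)
  refine ⟨N, fun {ι O o d S} hconv hclosed hdisj hsee hhid hS => ?_⟩
  obtain ⟨X, T, hTS, hT, hTX⟩ := hN S (fun X i j => Hit (O X) (d i) (d j))
    (fun _ _ _ h => hit_comm h) hS (fun i hi j hj hij => by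
      have := hhid i hi j hj hij
      simpa only [Seen, not_forall, not_not] using this)
  obtain ⟨f, hf, hfT, hbehind, hbetween, hcross⟩ := sortedFan (Y := fun k => O (X.succAbove k))
    (hconv X) (hclosed X) (fun _ => hconv _) (fun k => hdisj _ _ (Fin.succAbove_ne X k).symm) hT
    (fun i hi => hsee i (hTS hi) X) (fun i hi k => hsee i (hTS hi) _) hTX
  refine ⟨X, f, hf, fun i => hTS (hfT i), fun i j hij => hTX _ (hfT i) _ (hfT j) (hf.ne hij),
    fun i => ?_, hbetween, fun i e hs he => hcross i e (hs X) ?_⟩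
  · obtain ⟨a, ha, h1, h2⟩ := hbehind i
    refine ⟨a, ha, h1, fun k hk => ?_⟩
    obtain ⟨j, rfl⟩ := Fin.exists_succAbove_eq hk
    exact h2 j
  · simp only [Seen, not_forall, not_not] at he
    obtain ⟨k, hk⟩ := he
    have hkX : k ≠ X := by
      rintro rfl
      obtain ⟨a, ha, h1, -⟩ := hbehind i
      exact hs k (hit_of_shadow (hconv k) ha h1 hk)
    obtain ⟨j, rfl⟩ := Fin.exists_succAbove_eq hkX
    exact ⟨j, hk⟩

/-- Every child of the root carries a star whose two points have the same one of two properties `P true`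
and `P false`. Its leaf is adjacent to the middle one of three sorted neighbours, and its edge
crosses one of the outer two spokes. -/
lemma Drawing.exists_childStar {O : Fin 3 → Set (ℝ × ℝ)} {κ : Type} {r : ℝ × ℝ} {c : κ → ℝ × ℝ}
    {g l : κ → κ → ℝ × ℝ} (D : Drawing O r c g l) {N : ℕ}
    (hN : ∀ {d : κ → ℝ × ℝ} {o : ℝ × ℝ} {S : Finset κ}, (∀ i ∈ S, Seen O o (d i)) →
      (∀ i ∈ S, ∀ j ∈ S, i ≠ j → ¬ Seen O (d i) (d j)) → N ≤ S.card →
      ∃ X, ∃ f : Fin 3 → κ, Function.Injective f ∧ (∀ i, f i ∈ S) ∧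
        (∀ i j, i ≠ j → Hit (O X) (d (f i)) (d (f j))) ∧
        (∀ i, ∃ a ∈ O X, d (f i) ∈ segment ℝ o a ∧ ∀ k, k ≠ X → ¬ Hit (O k) o a) ∧
        ∀ i e, Seen O (d (f i)) e → ¬ Seen O o e →
          (∀ m < i, Cross (d (f i)) e o (d (f m))) ∨
            (∀ m, i < m → Cross (d (f i)) e o (d (f m)))) [Fintype κ] (hκ : 6 * N ≤ Fintype.card κ)
    {P : Bool → ℝ × ℝ → Prop} (i : κ) (hP : ∀ j, P true (g i j) ∨ P false (g i j)) :
    ∃ s B X j j', P s (g i j) ∧ P s (g i j') ∧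
      ChildStar O B X r (c i) (g i j) (g i j') (l i j') := by
  classical
  have hcol : ∀ j, ∃ p : Bool × Fin 3, P p.1 (g i j) ∧ Hit (O p.2) r (g i j) := by
    intro j
    have := D.hid_rg i j
    simp only [Seen, not_forall, not_not] at this
    obtain ⟨k, hk⟩ := this
    rcases hP j with h | h
    · exact ⟨(true, k), h, hk⟩
    · exact ⟨(false, k), h, hk⟩
  choose p hp1 hp2 using hcol
  by_cases hne : Nonempty κ
  · obtain ⟨⟨s, B⟩, -, hS⟩ := Finset.exists_le_card_fiber_of_mul_le_card_of_maps_to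
      (s := (Finset.univ : Finset κ)) (t := Finset.univ) (f := p) (n := N)
      (fun _ _ => Finset.mem_univ _) Finset.univ_nonempty (by simpa using hκ)
    obtain ⟨X, f, hf, hfS, hX, hbehind, hcross⟩ := hN (o := c i) (d := g i)
      (fun j _ => D.see_g i j) (fun j _ j' _ => D.hid_gg i j j') hS
    have hfp : ∀ m, p (f m) = (s, B) := fun m => (Finset.mem_filter.1 (hfS m)).2
    have hfs : ∀ m, P s (g i (f m)) := fun m => by simpa [hfp m] using hp1 (f m)
    have hfB : ∀ m, Hit (O B) r (g i (f m)) := fun m => by simpa [hfp m] using hp2 (f m)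
    have key : ∀ m, m ≠ 1 → Cross (g i (f 1)) (l i (f 1)) (c i) (g i (f m)) →
        ∃ s B X j j', P s (g i j) ∧ P s (g i j') ∧
          ChildStar O B X r (c i) (g i j) (g i j') (l i j') := fun m hm hc => by
      refine ⟨s, B, X, f m, f 1, hfs m, hfs 1, ?_⟩
      exact
      { see_g := D.see_g _ _, see_h := D.see_g _ _, see_l := D.see_l _ _, hit_rg := hfB m
        hit_rh := hfB 1, hit_gh := hX m 1 hm, behind_g := hbehind m, behind_h := hbehind 1
        cross_l := hc, hid_rl := D.hid_rl _ _, hid_cl := D.hid_cl _ _ _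
        hid_gl := D.hid_gl _ _ _ (hf.ne hm) }
    rcases hcross 1 (l i (f 1)) (D.see_l _ _) (D.hid_cl _ _ _) with h | h
    · exact key 0 (by decide) (h 0 (by decide))
    · exact key 2 (by decide) (h 2 (by decide))
  · exact absurd ⟨i⟩ hne

/-- Three convex obstacles do not suffice for a tree with enough children at every vertex. -/
theorem exists_not_drawing : ∃ K : ℕ, ∀ k, K ≤ k → ∀ {O : Fin 3 → Set (ℝ × ℝ)} {r : ℝ × ℝ}
    {c : Fin k → ℝ × ℝ} {g l : Fin k → Fin k → ℝ × ℝ}, ¬ Drawing O r c g l := by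
  obtain ⟨N₁, h₁⟩ := exists_sorted_star 37
  obtain ⟨N₂, h₂⟩ := exists_sorted_star 3
  refine ⟨N₁ + 6 * N₂, fun k hk O r c g l D => ?_⟩
  obtain ⟨A, f, hf, -, hA, hbehind, hbetween, hcross⟩ := h₁ (S := Finset.univ) D.conv D.closed
    D.disj (fun i _ => D.see_c i) (fun i _ j _ => D.hid_cc i j) (by simp; omega)
  -- a star at each of the children, and a side such that its edges cross the edges from `r` to all
  -- the children on this side; `true` stands for the side of the smaller indices
  have hstar : ∀ a, ∃ s : Bool, ∃ p : Fin 3 × Fin 3, ∃ j j',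
      ((∀ m, (if s then m < a else a < m) → Cross (c (f a)) (g (f a) j) r (c (f m))) ∧
      (∀ m, (if s then m < a else a < m) → Cross (c (f a)) (g (f a) j') r (c (f m)))) ∧
      ChildStar O p.1 p.2 r (c (f a)) (g (f a) j) (g (f a) j') (l (f a) j') := by
    intro a
    obtain ⟨s, B, X, j, j', h1, h2, S⟩ := D.exists_childStar (N := N₂)
      (P := fun s e => ∀ m, (if s then m < a else a < m) → Cross (c (f a)) e r (c (f m)))
      (fun hs hh hS => by
        obtain ⟨X, f, h1, h2, h3, h4, -, h5⟩ := h₂ D.conv D.closed D.disj hs hh hS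
        exact ⟨X, f, h1, h2, h3, h4, h5⟩) (by simp; omega) (f a) (fun j => by
        simpa using hcross a (g (f a) j) (D.see_g _ _) (D.hid_rg _ _))
    exact ⟨s, (B, X), j, j', ⟨h1, h2⟩, S⟩
  choose s p j j' hs S using hstar
  have key : ∀ a₀ a₁ a₂, a₀ ≠ a₁ → a₀ ≠ a₂ → a₁ ≠ a₂ → p a₁ = p a₂ →
      (if s a₁ then a₀ < a₁ else a₁ < a₀) → (if s a₂ then a₀ < a₂ else a₂ < a₀) →
      (if s a₂ then a₁ < a₂ else a₂ < a₁) → (∃ α β : ℝ, 0 ≤ α ∧ 0 ≤ β ∧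
        c (f a₁) - r = α • (c (f a₀) - r) + β • (c (f a₂) - r)) → False := by
    intro a₀ a₁ a₂ h01 h02 h12 hp o1 o2 o3 hb
    have hbehind' : ∀ a, ∃ z ∈ O A, c (f a) ∈ segment ℝ r z := fun a => by
      obtain ⟨z, hz, h, -⟩ := hbehind a
      exact ⟨z, hz, h⟩
    have R : RootStar O A r (c (f a₀)) (c (f a₁)) (c (f a₂)) :=
      { conv := D.conv, disj := D.disj, see₀ := D.see_c _, see₁ := D.see_c _, see₂ := D.see_c _
        hit₁₀ := hA _ _ h01.symm, hit₂₀ := hA _ _ h02.symm, hit₂₁ := hA _ _ h12.symm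
        behind₁ := hbehind' _, between := hb }
    have S₁ := S a₁
    rw [hp] at S₁
    refine R.elim ?_ S₁ (S a₂) ⟨D.hid_cg _ _ _ (hf.ne h01), (hs a₁).1 _ o1⟩
      ⟨D.hid_cg _ _ _ (hf.ne h01), (hs a₁).2 _ o1⟩ ⟨D.hid_cg _ _ _ (hf.ne h02), (hs a₂).2 _ o2⟩
      ⟨D.hid_cg _ _ _ (hf.ne h12), (hs a₂).2 _ o3⟩ (D.hid_cg _ _ _ (hf.ne h12.symm))
      (D.hid_cg _ _ _ (hf.ne h12.symm)) (D.hid_cl _ _ _)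
    intro hAB
    exact not_hit_root D.conv (hbehind' a₂) (S a₂).see_g (hAB ▸ (S a₂).hit_rg)
  -- there are `2 * 3 * 3` kinds of stars
  obtain ⟨q, -, hq⟩ := Finset.exists_lt_card_fiber_of_mul_lt_card_of_maps_to
    (s := (Finset.univ : Finset (Fin 37))) (t := Finset.univ) (f := fun a => (s a, p a)) (n := 2)
    (fun _ _ => Finset.mem_univ _) (by simp)
  set e := Finset.orderEmbOfCardLe _ (Nat.succ_le_of_lt hq)
  have he : ∀ m, (s (e m), p (e m)) = q := fun m =>
    (Finset.mem_filter.1 (Finset.orderEmbOfCardLe_mem _ (Nat.succ_le_of_lt hq) m)).2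
  have hes : ∀ m, s (e m) = q.1 := fun m => congrArg Prod.fst (he m)
  have hep : ∀ m m', p (e m) = p (e m') := fun m m' =>
    (congrArg Prod.snd (he m)).trans (congrArg Prod.snd (he m')).symm
  have h01 : e 0 < e 1 := e.strictMono (by decide)
  have h12 : e 1 < e 2 := e.strictMono (by decide)
  have hb := hbetween _ _ _ h01 h12
  cases hq1 : q.1 with
  | true =>
    refine key (e 0) (e 1) (e 2) h01.ne (h01.trans h12).ne h12.ne (hep _ _) ?_ ?_ ?_ hb
    all_goals simp only [hes, hq1, if_true]
    exacts [h01, h01.trans h12, h12]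
  | false =>
    obtain ⟨α, β, hα, hβ, hb⟩ := hb
    refine key (e 2) (e 1) (e 0) h12.ne' (h01.trans h12).ne' h01.ne' (hep _ _) ?_ ?_ ?_
      ⟨β, α, hβ, hα, by rw [hb, add_comm]⟩
    all_goals simp only [hes, hq1, Bool.false_eq_true, if_false]
    exacts [h12, h01.trans h12, h01]

/-! ### The full tree and its representations -/

lemma fullTree_adj_iff {k h : ℕ} {u v : {l : List (Fin k) // l.length ≤ h}} :
    (fullTree k h).Adj u v ↔ (∃ a, v.1 = a :: u.1) ∨ (∃ a, u.1 = a :: v.1) := Iff.rfl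

lemma fullTree_connected (k h : ℕ) : (fullTree k h).Connected := by
  have key : ∀ (l : List (Fin k)) (hl : l.length ≤ h),
      (fullTree k h).Reachable ⟨[], Nat.zero_le _⟩ ⟨l, hl⟩ := by
    intro l
    induction l with
    | nil => exact fun _ => SimpleGraph.Reachable.rfl
    | cons a l ih =>
      intro hl
      have hl' : l.length ≤ h := (Nat.le_succ _).trans hl
      refine (ih hl').trans (SimpleGraph.Adj.reachable ?_)
      exact .inl ⟨a, rfl⟩
  have : Nonempty {l : List (Fin k) // l.length ≤ h} := ⟨⟨[], Nat.zero_le _⟩⟩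
  exact ⟨fun u v => (key u.1 u.2).symm.trans (key v.1 v.2)⟩

/-- Without the edge from `u` to its child `v = a :: u`, the descendants of `v`, that is, the words
with suffix `v`, are only adjacent to each other. -/
lemma fullTree_isAcyclic (k h : ℕ) : (fullTree k h).IsAcyclic := by
  rw [SimpleGraph.isAcyclic_iff_forall_adj_isBridge]
  have key : ∀ u v : {l : List (Fin k) // l.length ≤ h}, ∀ a, v.1 = a :: u.1 →
      (fullTree k h).IsBridge s(u, v) := by
    intro u v a hv
    rw [SimpleGraph.isBridge_iff]
    have step : ∀ x y, ((fullTree k h) \ SimpleGraph.fromEdgeSet {s(u, v)}).Adj x y →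
        (∃ b, y.1 = b :: x.1) → (v.1 <:+ x.1 ↔ v.1 <:+ y.1) := by
      rintro x y hxy ⟨b, hb⟩
      rw [hb, List.suffix_cons_iff]
      refine ⟨.inr, fun h1 => h1.resolve_left fun h2 => ?_⟩
      have hyv : y = v := Subtype.ext (hb.trans h2.symm)
      have hxu : x = u := by
        rw [hv] at h2
        exact Subtype.ext (List.cons.inj h2).2.symm
      subst hyv hxu
      simp at hxy
      exact hxy.1.ne hxy.2
    have walk : ∀ x y, ((fullTree k h) \ SimpleGraph.fromEdgeSet {s(u, v)}).Reachable x y →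
        (v.1 <:+ x.1 ↔ v.1 <:+ y.1) := by
      rintro x y ⟨p⟩
      induction p with
      | nil => rfl
      | cons hadj p ih =>
        rw [← ih]
        rcases hadj.1 with h1 | h1
        · exact step _ _ hadj h1
        · exact (step _ _ hadj.symm h1).symm
    intro hr
    have h1 := ((walk u v hr).2 List.suffix_rfl).length_le
    rw [hv, List.length_cons] at h1
    omega
  rintro u v (⟨a, ha⟩ | ⟨a, ha⟩)
  · exact key u v a ha
  · rw [Sym2.eq_swap]; exact key v u a ha

/-- Coordinates on the plane. -/
noncomputable def planeCoord : Plane ≃L[ℝ] ℝ × ℝ :=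
  (EuclideanSpace.equiv (Fin 2) ℝ).trans (ContinuousLinearEquiv.finTwoArrow ℝ ℝ)

lemma seen_iff_disjoint {O : Fin 3 → Set Plane} {p q : Plane} :
    Seen (fun k => planeCoord '' O k) (planeCoord p) (planeCoord q) ↔
      ∀ k, Disjoint (segment ℝ p q) (O k) := by
  have e : segment ℝ (planeCoord p) (planeCoord q) = planeCoord '' segment ℝ p q :=
    (image_segment ℝ (planeCoord : Plane →ₗ[ℝ] ℝ × ℝ).toAffineMap p q).symm
  refine forall_congr' fun k => ?_
  rw [← Set.disjoint_image_iff planeCoord.injective, ← e, Set.disjoint_left]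
  simp [Hit]

/-- The obstacles of a representation, supplemented by empty sets. -/
def DisjointConvexObstacleRep.region {V : Type*} {G : SimpleGraph V} {h : ℕ}
    (D : DisjointConvexObstacleRep G h) (k : Fin 3) : Set Plane :=
  ⋃ hk : k.1 < h, (D.obstacle ⟨k, hk⟩).region

namespace DisjointConvexObstacleRep

variable {V : Type*} {G : SimpleGraph V} {h : ℕ} (D : DisjointConvexObstacleRep G h)

lemma region_eq_empty_or (k : Fin 3) : D.region k = ∅ ∨ ∃ i, D.region k = (D.obstacle i).region := by
  by_cases hk : k.1 < h
  · exact .inr ⟨⟨k, hk⟩, by simp [region, hk]⟩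
  · exact .inl (by simp [region, hk])

lemma convex_region (k : Fin 3) : Convex ℝ (D.region k) := by
  rcases D.region_eq_empty_or k with e | ⟨i, e⟩ <;> rw [e]
  · exact convex_empty
  · exact convex_convexHull ℝ ((D.obstacle i).verts : Set Plane)

lemma isCompact_region (k : Fin 3) : IsCompact (D.region k) := by
  rcases D.region_eq_empty_or k with e | ⟨i, e⟩ <;> rw [e]
  · exact isCompact_empty
  · exact (D.obstacle i).verts.finite_toSet.isCompact_convexHull (𝕜 := ℝ)

lemma disjoint_region {i j : Fin 3} (hij : i ≠ j) : Disjoint (D.region i) (D.region j) := by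
  simp only [region, Set.disjoint_iUnion_left, Set.disjoint_iUnion_right]
  intro hi hj
  exact D.pairwise_disjoint _ _ fun e => hij (Fin.ext (Fin.mk.inj_iff.1 e))

lemma adj_iff_seen (hh : h ≤ 3) {u v : V} (huv : u ≠ v) : G.Adj u v ↔
    Seen (fun k => planeCoord '' D.region k) (planeCoord (D.pt u)) (planeCoord (D.pt v)) := by
  rw [D.adj_iff u v huv, seen_iff_disjoint]
  simp only [region, Set.disjoint_iUnion_right]
  exact ⟨fun H k hk => H ⟨k, hk⟩, fun H i => H ⟨i, i.2.trans_le hh⟩ i.2⟩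

/-- The root, the words of lengths one and two, and, below each of the latter, the first child. -/
lemma drawing {k h : ℕ} (hk : 0 < k) (hh : h ≤ 3)
    (D : DisjointConvexObstacleRep (fullTree k 3) h) :
    Drawing (fun i => planeCoord '' D.region i) (planeCoord (D.pt ⟨[], by simp⟩))
      (fun i => planeCoord (D.pt ⟨[i], by simp⟩))
      (fun i j => planeCoord (D.pt ⟨[j, i], by simp⟩))
      (fun i j => planeCoord (D.pt ⟨[⟨0, hk⟩, j, i], by simp⟩)) := by
  have see : ∀ {u v}, (fullTree k 3).Adj u v →
      Seen (fun i => planeCoord '' D.region i) (planeCoord (D.pt u)) (planeCoord (D.pt v)) :=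
    fun huv => (D.adj_iff_seen hh huv.ne).1 huv
  have hid : ∀ {u v}, u ≠ v → ¬ (fullTree k 3).Adj u v →
      ¬ Seen (fun i => planeCoord '' D.region i) (planeCoord (D.pt u)) (planeCoord (D.pt v)) :=
    fun huv => mt (D.adj_iff_seen hh huv).2
  exact
  { conv := fun i => (D.convex_region i).linear_image (planeCoord : Plane →ₗ[ℝ] ℝ × ℝ)
    closed := fun i => ((D.isCompact_region i).image planeCoord.continuous).isClosed
    disj := fun i j hij => (Set.disjoint_image_iff planeCoord.injective).2 (D.disjoint_region hij)
    see_c := fun i => see (by simp [fullTree_adj_iff])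
    see_g := fun i j => see (by simp [fullTree_adj_iff])
    see_l := fun i j => see (by simp [fullTree_adj_iff])
    hid_cc := fun i i' hi => hid (by simpa using hi) (by simp [fullTree_adj_iff])
    hid_rg := fun i j => hid (by simp) (by simp [fullTree_adj_iff])
    hid_cg := fun i i' j hi => hid (by simp) (by simpa [fullTree_adj_iff] using hi.symm)
    hid_gg := fun i j j' hj => hid (by simpa using hj) (by simp [fullTree_adj_iff])
    hid_rl := fun i j => hid (by simp) (by simp [fullTree_adj_iff])
    hid_cl := fun i i' j => hid (by simp) (by simp [fullTree_adj_iff])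
    hid_gl := fun i j j' hj => hid (by simp) (by simpa [fullTree_adj_iff] using hj.symm) }

end DisjointConvexObstacleRep

theorem theorem2 :
    ∃ K : ℕ, ∀ k : ℕ, K ≤ k →
      (fullTree k 3).IsTree ∧ 4 ≤ disjointConvexObstacleNumber (fullTree k 3) := by
  obtain ⟨K, hK⟩ := exists_not_drawing
  refine ⟨K + 1, fun k hk => ⟨⟨fullTree_connected k 3, fullTree_isAcyclic k 3⟩, ?_⟩⟩
  refine le_iInf₂ fun h ⟨D⟩ => ?_
  by_contra hlt
  have hh : h ≤ 3 := by
    have : h < 4 := by exact_mod_cast not_le.1 hlt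
    omega
  exact hK k (by omega) (D.drawing (by omega) hh)
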